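/- Let $0<a<1$. Let $\Gamma_2$ be the group of automorphisms of the open unit disc $\mathbb{D}$ generated by $\beta(z)=-z$ and $\gamma(z)=\dfrac{a-z}{1-az}$, and let $\Gamma_1\subseteq\Gamma_2$ be the cyclic subgroup generated by $\alpha(z)=\beta(\gamma(z))=\dfrac{z-a}{1-az}$. Let $H^\infty_{\Gamma_2}$ be the algebra of bounded holomorphic functions $f$ on $\mathbb{D}$ with $f\circ\sigma=f$ for all $\sigma\in\Gamma_2$. Let $H^2_{\Gamma_2}$ be the subspace of all such invariant functions in the Hardy space $H^2$ (holomorphic functions on $\mathbb{D}$ with square-summable Taylor coefficients at $0$), and let $K^{\Gamma_2}$ be its reproducing kernel. For $F\in M_k(H^\infty_{\Gamma_2})$ put $\|F\|_\infty=\sup_{z\in\mathbb{D}}\|F(z)\|$, with the operator norm on $M_k=M_k(\mathbb{C})$. Then $\Gamma_2(0)=\Gamma_1(0)$, and the Blaschke product for this orbit, \[ B(z)=z\prod_{\zeta\in\Gamma_2(0),\ \zeta\neq 0}\frac{|\zeta|}{\zeta}\,\frac{\zeta-z}{1-\overline{\zeta}z}, \] converges for every $z\in\mathbb{D}$. Moreover,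 for any $n$ points $z_1,\dots,z_n\in\mathbb{D}$ and $n$ matrices $W_1,\dots,W_n\in M_k$ we have \[ \left[\frac{I-W_iW_j^*}{1-B(z_i)^2\,\overline{B(z_j)^2}}\right]_{i,j=1}^n=\Bigl[(I-W_iW_j^*)\,K^{\Gamma_2}(z_i,z_j)\Bigr]_{i,j=1}^n, \] and there exists $F\in M_k(H^\infty_{\Gamma_2})$ with $\|F\|_\infty\le 1$ and $F(z_j)=W_j$ for $j=1,\dots,n$ if and only if this $nk\times nk$ matrix is positive semidefinite. -/

import Mathlib

open scoped Complex.UnitDisc ComplexConjugate ComplexOrder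

noncomputable section

namespace PickDisc

/-! ### Automorphisms of the disc and the two groups -/

lemma one_sub_conj_mul_ne_zero (a z : 𝔻) : (1 : ℂ) - conj (a : ℂ) * z ≠ 0 := by
  intro h
  have h1 : conj (a : ℂ) * z = 1 := (sub_eq_zero.mp h).symm
  have h2 : ‖(a : ℂ)‖ * ‖(z : ℂ)‖ = 1 := by
    rw [← RCLike.norm_conj (a : ℂ), ← norm_mul, h1, norm_one]
  nlinarith [a.norm_lt_one, z.norm_lt_one, norm_nonneg (a : ℂ), norm_nonneg (z : ℂ)]

lemma norm_involution_lt_one (a z : 𝔻) :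
    ‖((a : ℂ) - z) / (1 - conj (a : ℂ) * z)‖ < 1 := by
  have hne := one_sub_conj_mul_ne_zero a z
  rw [norm_div, div_lt_one (norm_pos_iff.mpr hne)]
  refine lt_of_pow_lt_pow_left₀ 2 (norm_nonneg _) ?_
  have ha : ‖(a : ℂ)‖ ^ 2 < 1 := a.sq_norm_lt_one
  have hz : ‖(z : ℂ)‖ ^ 2 < 1 := z.sq_norm_lt_one
  rw [← Complex.normSq_eq_norm_sq] at ha hz ⊢
  rw [← Complex.normSq_eq_norm_sq]
  simp only [Complex.normSq_apply, Complex.sub_re, Complex.sub_im, Complex.mul_re, Complex.mul_im,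
    Complex.one_re, Complex.one_im, Complex.conj_re, Complex.conj_im] at ha hz ⊢
  nlinarith [mul_pos (sub_pos.mpr ha) (sub_pos.mpr hz)]

/-- The value `(a - z) / (1 - conj a * z)` as a point of the disc. -/
def involutionFun (a z : 𝔻) : 𝔻 :=
  .mk (((a : ℂ) - z) / (1 - conj (a : ℂ) * z)) (norm_involution_lt_one a z)

lemma involutionFun_involutive (a : 𝔻) : Function.Involutive (involutionFun a) := by
  intro z
  apply Complex.UnitDisc.coe_injective
  have hne := one_sub_conj_mul_ne_zero a z
  have hne2 := one_sub_conj_mul_ne_zero a (involutionFun a z)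
  have hne3 := one_sub_conj_mul_ne_zero a a
  simp only [involutionFun, Complex.UnitDisc.coe_mk] at hne2 ⊢
  rw [div_eq_iff hne2]
  have e : ((a : ℂ) - z) / (1 - conj (a : ℂ) * z) * (1 - conj (a : ℂ) * z) = a - z :=
    div_mul_cancel₀ _ hne
  refine mul_right_cancel₀ hne ?_
  linear_combination (conj (a : ℂ) * z - 1) * e

/-- The automorphism `z ↦ (a - z) / (1 - conj a * z)` of the unit disc. -/
def involution (a : 𝔻) : Equiv.Perm 𝔻 := (involutionFun_involutive a).toPerm

/-- A real number in `(0, 1)` as a point of the disc. -/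
def realPoint (a : ℝ) (ha : a ∈ Set.Ioo (0 : ℝ) 1) : 𝔻 :=
  .mk (a : ℂ) (by rw [Complex.norm_real, Real.norm_of_nonneg ha.1.le]; exact ha.2)

/-- `Γ₂`: the group generated by `β(z) = -z` and `γ(z) = (a - z) / (1 - a z)`. -/
def Gamma2 (a : ℝ) (ha : a ∈ Set.Ioo (0 : ℝ) 1) : Subgroup (Equiv.Perm 𝔻) :=
  Subgroup.closure {Equiv.neg 𝔻, involution (realPoint a ha)}

/-- `α = β ∘ γ`, see `translation_apply`. -/
def translation (a : ℝ) (ha : a ∈ Set.Ioo (0 : ℝ) 1) : Equiv.Perm 𝔻 :=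
  Equiv.neg 𝔻 * involution (realPoint a ha)

lemma translation_apply (a : ℝ) (ha : a ∈ Set.Ioo (0 : ℝ) 1) (z : 𝔻) :
    (translation a ha z : ℂ) = ((z : ℂ) - a) / (1 - a * z) := by
  simp [translation, involution, involutionFun, realPoint, ← neg_div]

/-- `Γ₁`: the cyclic group generated by `α(z) = (z - a) / (1 - a z)`. -/
def Gamma1 (a : ℝ) (ha : a ∈ Set.Ioo (0 : ℝ) 1) : Subgroup (Equiv.Perm 𝔻) :=
  Subgroup.zpowers (translation a ha)

/-! ### Blaschke products -/

open scoped Classical in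
/-- The normalised Blaschke factor with its zero at `ζ`; it is `z` when `ζ = 0`. -/
def blaschkeFactor (ζ z : 𝔻) : ℂ :=
  if ζ = 0 then (z : ℂ)
  else (‖(ζ : ℂ)‖ : ℂ) / ζ * (((ζ : ℂ) - z) / (1 - conj (ζ : ℂ) * z))

/-- The Blaschke product whose zeros are the points of `S`, each of multiplicity one. -/
def blaschkeProduct (S : Set 𝔻) (z : 𝔻) : ℂ := ∏' ζ : S, blaschkeFactor ζ z

/-! ### The algebra of bounded invariant holomorphic functions -/

/-- `H^∞_Γ`: the bounded holomorphic functions `f` on the disc with `f ∘ γ = f` for `γ ∈ Γ`. -/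
def HInfty (Γ : Subgroup (Equiv.Perm 𝔻)) : Subalgebra ℂ (𝔻 → ℂ) where
  carrier := {f | (∃ g : ℂ → ℂ, DifferentiableOn ℂ g (Metric.ball 0 1) ∧ ∀ z : 𝔻, f z = g z) ∧
    (∃ C : ℝ, ∀ z, ‖f z‖ ≤ C) ∧ ∀ γ ∈ Γ, f ∘ γ = f}
  mul_mem' := by
    rintro f f' ⟨⟨g, hg, hfg⟩, ⟨C, hC⟩, hf⟩ ⟨⟨g', hg', hfg'⟩, ⟨C', hC'⟩, hf'⟩
    refine ⟨⟨fun z => g z * g' z, hg.mul hg', fun z => by simp [hfg, hfg']⟩,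
      ⟨C * C', fun z => ?_⟩, fun γ hγ => ?_⟩
    · rw [Pi.mul_apply, norm_mul]
      exact mul_le_mul (hC z) (hC' z) (norm_nonneg _) ((norm_nonneg _).trans (hC z))
    · rw [Pi.mul_comp, hf γ hγ, hf' γ hγ]
  add_mem' := by
    rintro f f' ⟨⟨g, hg, hfg⟩, ⟨C, hC⟩, hf⟩ ⟨⟨g', hg', hfg'⟩, ⟨C', hC'⟩, hf'⟩
    refine ⟨⟨fun z => g z + g' z, hg.add hg', fun z => by simp [hfg, hfg']⟩,
      ⟨C + C', fun z => (norm_add_le _ _).trans (add_le_add (hC z) (hC' z))⟩, fun γ hγ => ?_⟩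
    rw [Pi.add_comp, hf γ hγ, hf' γ hγ]
  algebraMap_mem' c :=
    ⟨⟨fun _ => c, differentiableOn_const c, fun _ => rfl⟩, ⟨‖c‖, fun _ => le_rfl⟩, fun _ _ => rfl⟩

/-- The value at `z` of a matrix of functions. -/
def evalAt {Γ : Subgroup (Equiv.Perm 𝔻)} {k : ℕ} (F : Matrix (Fin k) (Fin k) (HInfty Γ)) (z : 𝔻) :
    Matrix (Fin k) (Fin k) ℂ :=
  F.map fun f => (f : 𝔻 → ℂ) z

open scoped Matrix.Norms.L2Operator in
/-- The norm of `M_k(H^∞_Γ)`: the supremum over the disc of the operator norm (with respect to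
the Euclidean norm on `ℂ^k`) of the values. -/
def supNorm {Γ : Subgroup (Equiv.Perm 𝔻)} {k : ℕ} (F : Matrix (Fin k) (Fin k) (HInfty Γ)) : ℝ :=
  ⨆ z : 𝔻, ‖evalAt F z‖

/-! ### The Hardy space of invariant functions and its reproducing kernel

An element of the Hardy space `H²` is represented by its square-summable sequence of Taylor
coefficients at the origin, with the inner product of `ℓ²`. -/

/-- The function on the disc with Taylor coefficients `f`. -/
def hardyFun (f : lp (fun _ : ℕ => ℂ) 2) (z : 𝔻) : ℂ := ∑' n, f n * (z : ℂ) ^ n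

lemma memℓp_szego (z : 𝔻) : Memℓp (fun n : ℕ => conj (z : ℂ) ^ n) 2 := by
  refine memℓp_gen ?_
  have : Summable fun n : ℕ => (‖(z : ℂ)‖ ^ 2) ^ n :=
    summable_geometric_of_lt_one (by positivity) z.sq_norm_lt_one
  refine this.congr fun n => ?_
  simp [← pow_mul, mul_comm]

/-- Point evaluation on `H²`. -/
def hardyEval (z : 𝔻) : lp (fun _ : ℕ => ℂ) 2 →L[ℂ] ℂ :=
  innerSL ℂ (⟨fun n : ℕ => conj (z : ℂ) ^ n, memℓp_szego z⟩ : lp (fun _ : ℕ => ℂ) 2)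

lemma hardyEval_apply (f : lp (fun _ : ℕ => ℂ) 2) (z : 𝔻) : hardyEval z f = hardyFun f z := by
  rw [hardyEval, innerSL_apply_apply, lp.inner_eq_tsum, hardyFun]
  refine tsum_congr fun n => ?_
  simp [mul_comm]

lemma hardyFun_hasSum (f : lp (fun _ : ℕ => ℂ) 2) (z : 𝔻) :
    HasSum (fun n => f n * (z : ℂ) ^ n) (hardyFun f z) := by
  have := lp.summable_inner (𝕜 := ℂ)
    (⟨fun n : ℕ => conj (z : ℂ) ^ n, memℓp_szego z⟩ : lp (fun _ : ℕ => ℂ) 2) f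
  refine (this.congr fun n => ?_).hasSum
  simp [mul_comm]

lemma hardyFun_eq_zero {f : lp (fun _ : ℕ => ℂ) 2} (h : ∀ z, hardyFun f z = 0) : f = 0 := by
  have key : HasFPowerSeriesAt (0 : ℂ → ℂ)
      (FormalMultilinearSeries.ofScalars ℂ (fun n => f n)) 0 := by
    rw [hasFPowerSeriesAt_iff]
    filter_upwards [Metric.ball_mem_nhds (0 : ℂ) one_pos] with z hz
    have hz' : ‖z‖ < 1 := by simpa using hz
    have := hardyFun_hasSum f (.mk z hz')
    rw [h] at this
    simpa [FormalMultilinearSeries.coeff_ofScalars, mul_comm] using this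
  have h0 := key.eq_zero
  ext n
  have := congrArg (fun p => FormalMultilinearSeries.coeff p n) h0
  simp only [FormalMultilinearSeries.coeff_ofScalars] at this
  simpa [FormalMultilinearSeries.coeff] using this

/-- `H²_Γ`: the functions `f` in `H²` with `f ∘ γ = f` for `γ ∈ Γ`. -/
def HTwo (Γ : Subgroup (Equiv.Perm 𝔻)) : Submodule ℂ (lp (fun _ : ℕ => ℂ) 2) where
  carrier := {f | ∀ γ ∈ Γ, hardyFun f ∘ γ = hardyFun f}
  zero_mem' := fun γ _ => by ext z; simp [hardyFun]
  add_mem' := by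
    intro f g hf hg γ hγ
    ext z
    have h1 := congrFun (hf γ hγ) z
    have h2 := congrFun (hg γ hγ) z
    simp only [Function.comp_apply, ← hardyEval_apply, map_add] at h1 h2 ⊢
    rw [h1, h2]
  smul_mem' := by
    intro c f hf γ hγ
    ext z
    have h1 := congrFun (hf γ hγ) z
    simp only [Function.comp_apply, ← hardyEval_apply, map_smul] at h1 ⊢
    rw [h1]

lemma isClosed_HTwo (Γ : Subgroup (Equiv.Perm 𝔻)) :
    IsClosed (HTwo Γ : Set (lp (fun _ : ℕ => ℂ) 2)) := by
  have : (HTwo Γ : Set (lp (fun _ : ℕ => ℂ) 2)) =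
      ⋂ γ ∈ Γ, ⋂ z : 𝔻, {f | hardyEval (γ z) f = hardyEval z f} := by
    ext f
    simp only [Set.mem_iInter, Set.mem_ofPred_eq, hardyEval_apply]
    exact ⟨fun h γ hγ z => congrFun (h γ hγ) z, fun h γ hγ => funext (h γ hγ)⟩
  rw [this]
  exact isClosed_iInter fun γ => isClosed_iInter fun _ => isClosed_iInter fun z =>
    isClosed_eq (hardyEval (γ z)).continuous (hardyEval z).continuous

instance (Γ : Subgroup (Equiv.Perm 𝔻)) : CompleteSpace (HTwo Γ) :=
  (isClosed_HTwo Γ).completeSpace_coe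

/-- `H²_Γ` as a Hilbert space of functions on the disc. -/
instance (Γ : Subgroup (Equiv.Perm 𝔻)) : RKHS ℂ (HTwo Γ) 𝔻 ℂ where
  coeCLM := ContinuousLinearMap.pi fun z => hardyEval z ∘L (HTwo Γ).subtypeL
  coeCLM_injective := by
    refine (injective_iff_map_eq_zero _).mpr fun f hf => Subtype.ext ?_
    refine hardyFun_eq_zero fun z => ?_
    rw [← hardyEval_apply]
    exact congrFun hf z

lemma HTwo_coe_apply (Γ : Subgroup (Equiv.Perm 𝔻)) (f : HTwo Γ) (z : 𝔻) :
    f z = hardyFun (f : lp (fun _ : ℕ => ℂ) 2) z :=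
  hardyEval_apply _ z

/-- `K^Γ(z, w)`: the reproducing kernel of `H²_Γ`, i.e. the value at `z` of the element `k_w`
of `H²_Γ` representing the evaluation at `w`. -/
def invKernel (Γ : Subgroup (Equiv.Perm 𝔻)) (z w : 𝔻) : ℂ := RKHS.kernel (HTwo Γ) z w 1

lemma invKernel_eq (Γ : Subgroup (Equiv.Perm 𝔻)) (z w : 𝔻) :
    invKernel Γ z w = RKHS.kerFun (HTwo Γ) w 1 z :=
  (RKHS.kerFun_apply (HTwo Γ) w 1 z).symm

/-! ### Pick matrices -/

/-- The `nk × nk` matrix made of the `k × k` blocks `K(z_i, z_j) (I - W_i W_j*)`. -/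
def pickMatrix {n k : ℕ} (K : 𝔻 → 𝔻 → ℂ) (z : Fin n → 𝔻) (W : Fin n → Matrix (Fin k) (Fin k) ℂ) :
    Matrix (Fin n × Fin k) (Fin n × Fin k) ℂ :=
  Matrix.comp (Fin n) (Fin n) (Fin k) (Fin k) ℂ
    (Matrix.of fun i j => K (z i) (z j) • (1 - W i * (W j).conjTranspose))

end PickDisc

end

noncomputable section

namespace PickDisc

open Filter Topology

/-! ### The Hardy space -/

/-! In the coordinate `t = (1 + z) / (1 - z)` the map `α` is multiplication by `q = (1 - a) / (1 +
a)` and `β` is `t ↦ 1 / t`. Hence both groups send `0` to the points `(q ^ n - 1) / (q ^ n + 1)`,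
which approach the circle geometrically, and `B` converges.

Kernel. Multiplication by `B` is an isometry of `H²`, and every function vanishing on the orbit is
divisible by `B` (`exists_isometry_mul_blaschkeProduct`). The generators permute the zeros and
change `B` at most by a sign, so `B²` is invariant. If `f` is invariant and `f(0) = 0`, then `f = B
g`. Since `B` is odd, so is `g`; thus `g(0) = 0`, and since `g²` is invariant, `g` vanishes on the
whole orbit. So `f = B² h` with `h` invariant (`exists_orbitMul_sq`). Therefore `H²_Γ₂` is the
orthogonal sum of the constants and `B² H²_Γ₂`, and its kernel functions satisfy `k_w = 1 + conj
(B(w)²) B² k_w`; solving for `k_w` gives `invKernel_Gamma2`.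

Necessity. A matrix `F` of sup norm at most one acts contractively on tuples in `H²_Γ₂`, and its
adjoint acts on kernel functions through the matrices `W_j*`; the Pick form is the resulting defect
of norms (`posSemidef_pickMatrix_invKernel`).

Sufficiency. By the kernel formula the matrix is the classical Pick matrix at the points `B(z_j)²`.
A Gram factorisation and a lurking isometry give a contractive holomorphic `G` on the disc with
`G(B(z_j)²) = W_j` (`exists_interpolant`), and `F = G ∘ B²` is invariant. -/

/-- The Hardy space, as the space of Taylor coefficients. -/
abbrev Hardy := lp (fun _ : ℕ => ℂ) 2

lemma hardyFun_add (f g : Hardy) (z : 𝔻) : hardyFun (f + g) z = hardyFun f z + hardyFun g z := by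
  simp only [← hardyEval_apply, map_add]

lemma hardyFun_sub (f g : Hardy) (z : 𝔻) : hardyFun (f - g) z = hardyFun f z - hardyFun g z := by
  simp only [← hardyEval_apply, map_sub]

lemma hardyFun_smul (c : ℂ) (f : Hardy) (z : 𝔻) : hardyFun (c • f) z = c * hardyFun f z := by
  simp only [← hardyEval_apply, map_smul, smul_eq_mul]

lemma hardyFun_ext {f g : Hardy} (h : ∀ z, hardyFun f z = hardyFun g z) : f = g :=
  sub_eq_zero.mp <| hardyFun_eq_zero fun z => by rw [hardyFun_sub, h, sub_self]

lemma tendsto_hardyFun {ι : Type*} {l : Filter ι} {f : ι → Hardy} {g : Hardy}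
    (h : Filter.Tendsto f l (nhds g)) (z : 𝔻) :
    Filter.Tendsto (fun i => hardyFun (f i) z) l (nhds (hardyFun g z)) := by
  simp only [← hardyEval_apply]
  exact ((hardyEval z).continuous.tendsto g).comp h

/-- The Szegő kernel function at `z`. -/
def szego (z : 𝔻) : Hardy := ⟨fun n : ℕ => conj (z : ℂ) ^ n, memℓp_szego z⟩

lemma inner_szego (z : 𝔻) (f : Hardy) : inner ℂ (szego z) f = hardyFun f z :=
  hardyEval_apply f z

lemma hardyFun_szego (w z : 𝔻) : hardyFun (szego w) z = (1 - conj (w : ℂ) * z)⁻¹ := by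
  have h : ‖conj (w : ℂ) * z‖ < 1 := by
    rw [norm_mul, RCLike.norm_conj]
    nlinarith [w.norm_lt_one, z.norm_lt_one, norm_nonneg (w : ℂ), norm_nonneg (z : ℂ)]
  rw [← tsum_geometric_of_norm_lt_one h, hardyFun]
  exact tsum_congr fun n => (mul_pow _ _ _).symm

lemma hardyFun_szego_zero (z : 𝔻) : hardyFun (szego 0) z = 1 := by
  simp [hardyFun_szego]

lemma memℓp_shift (f : Hardy) : Memℓp (fun n : ℕ => (Nat.casesOn n 0 fun m => f m : ℂ)) 2 :=
  memℓp_gen ((summable_nat_add_iff 1).mp ((lp.memℓp f).summable (by norm_num)))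

/-- The shift of the Taylor coefficients, as a function. -/
def shiftFun (f : Hardy) : Hardy := ⟨_, memℓp_shift f⟩

lemma shiftFun_zero (f : Hardy) : shiftFun f 0 = 0 := rfl

lemma shiftFun_succ (f : Hardy) (n : ℕ) : shiftFun f (n + 1) = f n := rfl

lemma inner_shiftFun (f g : Hardy) : inner ℂ (shiftFun f) (shiftFun g) = inner ℂ f g := by
  have h := (lp.summable_inner (𝕜 := ℂ) (shiftFun f) (shiftFun g)).tsum_eq_zero_add
  rw [lp.inner_eq_tsum, lp.inner_eq_tsum, h, shiftFun_zero, inner_zero_left, zero_add]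
  rfl

/-- Multiplication by the coordinate, as a linear map. -/
def shiftLin : Hardy →ₗ[ℂ] Hardy where
  toFun := shiftFun
  map_add' f g := by
    ext n
    cases n <;> simp [shiftFun_zero, shiftFun_succ]
  map_smul' c f := by
    ext n
    cases n <;> simp [shiftFun_zero, shiftFun_succ]

/-- Multiplication by the coordinate. -/
def shift : Hardy →ₗᵢ[ℂ] Hardy := shiftLin.isometryOfInner inner_shiftFun

lemma hardyFun_shift (f : Hardy) (z : 𝔻) : hardyFun (shift f) z = z * hardyFun f z := by
  rw [hardyFun, (hardyFun_hasSum (shift f) z).summable.tsum_eq_zero_add, hardyFun, ← tsum_mul_left]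
  have h0 : shift f 0 = 0 := rfl
  have h1 : ∀ n, shift f (n + 1) = f n := fun _ => rfl
  simp only [h0, h1, zero_mul, zero_add]
  exact tsum_congr fun n => by ring

/-! ### Blaschke factors as multipliers -/

lemma exists_blaschkeFactor_eq (ζ : 𝔻) : ∃ c : ℂ, ‖c‖ = 1 ∧
    ∀ z : 𝔻, blaschkeFactor ζ z = c * (((ζ : ℂ) - z) / (1 - conj (ζ : ℂ) * z)) := by
  by_cases h : ζ = 0
  -- At `ζ = 0` the quotient is `-z` while the normalised factor is `z`.
  · exact ⟨-1, by simp, fun z => by simp [blaschkeFactor, h]⟩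
  · have h' : (ζ : ℂ) ≠ 0 := by simpa using h
    refine ⟨‖(ζ : ℂ)‖ / ζ, ?_, fun z => by simp [blaschkeFactor, h]⟩
    rw [norm_div, Complex.norm_real, norm_norm, div_self (norm_ne_zero_iff.mpr h')]

lemma norm_blaschkeFactor_lt_one (ζ z : 𝔻) : ‖blaschkeFactor ζ z‖ < 1 := by
  obtain ⟨c, hc, h⟩ := exists_blaschkeFactor_eq ζ
  rw [h, norm_mul, hc, one_mul]
  exact norm_involution_lt_one ζ z

lemma blaschkeFactor_eq_zero {ζ z : 𝔻} : blaschkeFactor ζ z = 0 ↔ z = ζ := by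
  obtain ⟨c, hc, h⟩ := exists_blaschkeFactor_eq ζ
  have hc' : c ≠ 0 := by
    rintro rfl
    simp at hc
  rw [h, mul_eq_zero, div_eq_zero_iff, sub_eq_zero, Complex.UnitDisc.coe_inj, eq_comm (a := ζ)]
  simp [hc', one_sub_conj_mul_ne_zero]

/-- The solution of `(1 - conj ζ * z) u = f` in the Hardy space. -/
lemma exists_resolvent (ζ : 𝔻) : ∃ R : Hardy →ₗ[ℂ] Hardy,
    ∀ f, R f - conj (ζ : ℂ) • shift (R f) = f := by
  set t : Hardy →L[ℂ] Hardy := conj (ζ : ℂ) • shift.toContinuousLinearMap with ht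
  have hlt : ‖t‖ < 1 := by
    refine lt_of_le_of_lt ?_ ζ.norm_lt_one
    refine ContinuousLinearMap.opNorm_le_bound _ (norm_nonneg _) fun f => ?_
    simp [ht, norm_smul]
  refine ⟨(((Units.oneSub t hlt)⁻¹ : (Hardy →L[ℂ] Hardy)ˣ) : Hardy →L[ℂ] Hardy), fun f => ?_⟩
  have := congrArg (fun A : Hardy →L[ℂ] Hardy => A f) (Units.oneSub t hlt).mul_inv
  simpa [ht] using this

/-- With `S` the shift and `R` the inverse of `1 - conj ζ S`, the operator is `c (ζ - S) R`.
Expanding squares and using `‖S u‖ = ‖u‖` gives `‖ζ u - S u‖ = ‖u - conj ζ S u‖`; take `u = R f`. -/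
lemma exists_isometry_mul_blaschkeFactor (ζ : 𝔻) : ∃ T : Hardy →ₗᵢ[ℂ] Hardy,
    ∀ f z, hardyFun (T f) z = blaschkeFactor ζ z * hardyFun f z := by
  obtain ⟨c, hc, hb⟩ := exists_blaschkeFactor_eq ζ
  obtain ⟨R, hR⟩ := exists_resolvent ζ
  refine ⟨⟨c • ((ζ : ℂ) • R - shift.toLinearMap ∘ₗ R), fun f => ?_⟩, fun f z => ?_⟩
  · have h1 : ‖(ζ : ℂ) • R f - shift (R f)‖ ^ 2 = ‖R f - conj (ζ : ℂ) • shift (R f)‖ ^ 2 := by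
      rw [@norm_sub_sq ℂ, @norm_sub_sq ℂ, norm_smul, norm_smul, inner_smul_left, inner_smul_right,
        RCLike.norm_conj, LinearIsometry.norm_map]
      ring
    have h2 := (sq_eq_sq₀ (norm_nonneg _) (norm_nonneg _)).mp h1
    rw [hR] at h2
    simp only [LinearMap.smul_apply, LinearMap.sub_apply, norm_smul, hc, one_mul]
    exact h2
  · have h1 : hardyFun (R f) z - conj (ζ : ℂ) * (z * hardyFun (R f) z) = hardyFun f z := by
      conv_rhs => rw [← hR f]
      rw [hardyFun_sub, hardyFun_smul, hardyFun_shift]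
    have h2 : hardyFun (c • ((ζ : ℂ) • R f - shift (R f))) z =
        c * (ζ * hardyFun (R f) z - z * hardyFun (R f) z) := by
      rw [hardyFun_smul, hardyFun_sub, hardyFun_smul, hardyFun_shift]
    refine h2.trans ?_
    have h3 := one_sub_conj_mul_ne_zero ζ z
    rw [hb, ← h1, mul_assoc c, div_mul_eq_mul_div,
      show hardyFun (R f) z - conj (ζ : ℂ) * (z * hardyFun (R f) z) =
        hardyFun (R f) z * (1 - conj (ζ : ℂ) * z) by ring, ← mul_assoc, mul_div_cancel_right₀ _ h3]
    ring

/-- Multiplication by the Blaschke factor at `ζ`. -/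
def factorMul (ζ : 𝔻) : Hardy →ₗᵢ[ℂ] Hardy := (exists_isometry_mul_blaschkeFactor ζ).choose

lemma hardyFun_factorMul (ζ : 𝔻) (f : Hardy) (z : 𝔻) :
    hardyFun (factorMul ζ f) z = blaschkeFactor ζ z * hardyFun f z :=
  (exists_isometry_mul_blaschkeFactor ζ).choose_spec f z

/-- The left side is `T T*` applied to the Szegő function at `w`, where `T = factorMul ζ`. Thus `T
T*` fixes Szegő functions up to multiples of `szego ζ`, which is what division by the factor needs.
-/
lemma conj_blaschkeFactor_smul_szego (ζ w : 𝔻) : ∃ c : ℂ,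
    conj (blaschkeFactor ζ w) • factorMul ζ (szego w) = szego w - c • szego ζ := by
  obtain ⟨c, hc, hb⟩ := exists_blaschkeFactor_eq ζ
  refine ⟨(1 - conj (ζ : ℂ) * ζ) / (1 - ζ * conj (w : ℂ)), hardyFun_ext fun z => ?_⟩
  have hcc : conj c * c = 1 := by
    rw [← Complex.normSq_eq_conj_mul_self, Complex.normSq_eq_norm_sq, hc]
    simp
  rw [hardyFun_smul, hardyFun_factorMul, hardyFun_sub, hardyFun_smul, hardyFun_szego,
    hardyFun_szego, hb, hb, map_mul, map_div₀]
  simp only [map_sub, map_mul, map_one, Complex.conj_conj]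
  have h1 := one_sub_conj_mul_ne_zero w z
  have h2 := one_sub_conj_mul_ne_zero ζ z
  have h3 := one_sub_conj_mul_ne_zero w ζ
  have h3' := h3
  rw [mul_comm] at h3
  have h4 : conj c * ((conj (ζ : ℂ) - conj (w : ℂ)) / (1 - ζ * conj (w : ℂ))) *
      (c * ((ζ - z) / (1 - conj (ζ : ℂ) * z)) * (1 - conj (w : ℂ) * z)⁻¹) =
      (conj c * c) * (((conj (ζ : ℂ) - conj (w : ℂ)) / (1 - ζ * conj (w : ℂ))) *
      (((ζ - z) / (1 - conj (ζ : ℂ) * z)) * (1 - conj (w : ℂ) * z)⁻¹)) := by ring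
  rw [h4, hcc]
  field_simp
  ring

lemma exists_factorMul_eq {ζ : 𝔻} {f : Hardy} (hf : hardyFun f ζ = 0) :
    ∃ h, factorMul ζ h = f := by
  -- For an isometry `T` the only candidate for the quotient is `T* f`.
  refine ⟨(factorMul ζ).toContinuousLinearMap.adjoint f, hardyFun_ext fun w => ?_⟩
  obtain ⟨c, hc⟩ := conj_blaschkeFactor_smul_szego ζ w
  have h := congrArg (fun g => inner ℂ g f) hc
  simp only [inner_sub_left, inner_smul_left, inner_szego, hf, Complex.conj_conj, mul_zero,
    sub_zero] at h
  rw [hardyFun_factorMul, ← inner_szego w, ContinuousLinearMap.adjoint_inner_right]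
  exact h

section

/-! ### Convergence of Blaschke products -/

lemma norm_one_sub_blaschkeFactor_le (ζ w : 𝔻) :
    ‖1 - blaschkeFactor ζ w‖ ≤ (1 + ‖(w : ℂ)‖) / (1 - ‖(w : ℂ)‖) * (1 - ‖(ζ : ℂ)‖) := by
  have hw : 0 < 1 - ‖(w : ℂ)‖ := sub_pos.mpr w.norm_lt_one
  have hζ1 : 0 < 1 - ‖(ζ : ℂ)‖ := sub_pos.mpr ζ.norm_lt_one
  by_cases h : ζ = 0
  · subst h
    simp only [blaschkeFactor, if_true, Complex.UnitDisc.coe_zero, norm_zero, sub_zero, mul_one]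
    calc ‖1 - (w : ℂ)‖ ≤ ‖(1 : ℂ)‖ + ‖(w : ℂ)‖ := norm_sub_le _ _
      _ = (1 + ‖(w : ℂ)‖) / 1 := by simp
      _ ≤ _ := by
        gcongr
        linarith [norm_nonneg (w : ℂ)]
  · have h' : (ζ : ℂ) ≠ 0 := by simpa using h
    have hp : 0 < ‖(ζ : ℂ)‖ := norm_pos_iff.mpr h'
    have hne := one_sub_conj_mul_ne_zero ζ w
    have hsq : (ζ : ℂ) * conj (ζ : ℂ) = (‖(ζ : ℂ)‖ : ℂ) ^ 2 := by
      rw [Complex.mul_conj, Complex.normSq_eq_norm_sq]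
      push_cast
      rfl
    -- The normalisation `|ζ| / ζ` is what makes `1 - |ζ|` split off.
    have key : 1 - blaschkeFactor ζ w =
        ((ζ : ℂ) + ‖(ζ : ℂ)‖ * w) / (ζ * (1 - conj (ζ : ℂ) * w)) * (1 - ‖(ζ : ℂ)‖ : ℝ) := by
      rw [blaschkeFactor, if_neg h, div_mul_div_comm, div_mul_eq_mul_div,
        eq_div_iff (mul_ne_zero h' hne), sub_mul, div_mul_cancel₀ _ (mul_ne_zero h' hne)]
      push_cast
      linear_combination (-(w : ℂ)) * hsq
    rw [key, norm_mul, norm_div, norm_mul, Complex.norm_real, Real.norm_of_nonneg hζ1.le]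
    refine mul_le_mul_of_nonneg_right ?_ hζ1.le
    have h1 : ‖(ζ : ℂ) + ‖(ζ : ℂ)‖ * w‖ ≤ ‖(ζ : ℂ)‖ * (1 + ‖(w : ℂ)‖) := by
      refine (norm_add_le _ _).trans_eq ?_
      rw [norm_mul, Complex.norm_real, norm_norm]
      ring
    have h2 : 1 - ‖(w : ℂ)‖ ≤ ‖1 - conj (ζ : ℂ) * w‖ := by
      have := norm_sub_norm_le (1 : ℂ) (conj (ζ : ℂ) * w)
      rw [norm_one, norm_mul, RCLike.norm_conj] at this
      nlinarith [ζ.norm_lt_one, norm_nonneg (w : ℂ)]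
    calc _ ≤ (‖(ζ : ℂ)‖ * (1 + ‖(w : ℂ)‖)) / (‖(ζ : ℂ)‖ * (1 - ‖(w : ℂ)‖)) := by gcongr
      _ = _ := mul_div_mul_left _ _ hp.ne'

variable {S : Set 𝔻}

lemma summable_one_sub_norm (hS : Summable fun ζ : S => √(1 - ‖(ζ : ℂ)‖)) :
    Summable fun ζ : S => 1 - ‖((ζ : 𝔻) : ℂ)‖ := by
  refine hS.of_nonneg_of_le (fun ζ => (sub_pos.mpr (ζ : 𝔻).norm_lt_one).le) fun ζ => ?_
  refine Real.le_sqrt_of_sq_le ?_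
  nlinarith [(ζ : 𝔻).norm_lt_one, norm_nonneg ((ζ : 𝔻) : ℂ)]

lemma multipliable_blaschkeFactor (hS : Summable fun ζ : S => √(1 - ‖(ζ : ℂ)‖)) (w : 𝔻) :
    Multipliable fun ζ : S => blaschkeFactor ζ w := by
  have h : Summable fun ζ : S => ‖blaschkeFactor ζ w - 1‖ := by
    refine ((summable_one_sub_norm hS).mul_left
      ((1 + ‖(w : ℂ)‖) / (1 - ‖(w : ℂ)‖))).of_nonneg_of_le (fun _ => norm_nonneg _) fun ζ => ?_
    rw [norm_sub_rev]
    exact norm_one_sub_blaschkeFactor_le ζ w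
  simpa using multipliable_one_add_of_summable h

lemma tendsto_blaschkeProduct (hS : Summable fun ζ : S => √(1 - ‖(ζ : ℂ)‖)) (w : 𝔻) :
    Tendsto (fun F : Finset S => ∏ ζ ∈ F, blaschkeFactor ζ w) atTop (𝓝 (blaschkeProduct S w)) :=
  (multipliable_blaschkeFactor hS w).hasProd

lemma norm_blaschkeProduct_le (hS : Summable fun ζ : S => √(1 - ‖(ζ : ℂ)‖)) (h0 : 0 ∈ S) (w : 𝔻) :
    ‖blaschkeProduct S w‖ ≤ ‖(w : ℂ)‖ := by
  classical
  refine le_of_tendsto (tendsto_blaschkeProduct hS w).norm ?_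
  filter_upwards [eventually_ge_atTop {⟨0, h0⟩}] with F hF
  rw [← Finset.mul_prod_erase F _ (Finset.singleton_subset_iff.mp hF), norm_mul, norm_prod]
  have h1 : blaschkeFactor (⟨0, h0⟩ : S) w = w := by simp [blaschkeFactor]
  rw [h1]
  exact mul_le_of_le_one_right (norm_nonneg _)
    (Finset.prod_le_one (fun _ _ => norm_nonneg _) fun ζ _ => (norm_blaschkeFactor_lt_one ζ w).le)

/-! ### Multiplication by a Blaschke product -/

/-- Since multiplication by the factor `b` is isometric, the squared norm is `2 ‖k_w‖² (1 - Re
b(w))`, of order `1 - |ζ|`. The square root is the reason for assuming `√(1 - |ζ|)` summable, which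
is stronger than the Blaschke condition. -/
lemma norm_factorMul_szego_sub_le (ζ w : 𝔻) : ‖factorMul ζ (szego w) - szego w‖ ≤
    √(2 * ‖szego w‖ ^ 2 * ((1 + ‖(w : ℂ)‖) / (1 - ‖(w : ℂ)‖))) * √(1 - ‖(ζ : ℂ)‖) := by
  have hw : 0 < 1 - ‖(w : ℂ)‖ := sub_pos.mpr w.norm_lt_one
  rw [← Real.sqrt_mul (by positivity)]
  refine Real.le_sqrt_of_sq_le ?_
  have h1 : inner ℂ (szego w) (factorMul ζ (szego w)) =
      blaschkeFactor ζ w * ((‖szego w‖ ^ 2 : ℝ) : ℂ) := by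
    rw [inner_szego, hardyFun_factorMul, ← inner_szego, inner_self_eq_norm_sq_to_K]
    push_cast
    rfl
  have h2 : (1 - blaschkeFactor ζ w).re ≤
      (1 + ‖(w : ℂ)‖) / (1 - ‖(w : ℂ)‖) * (1 - ‖(ζ : ℂ)‖) :=
    (Complex.re_le_norm _).trans (norm_one_sub_blaschkeFactor_le ζ w)
  rw [norm_sub_rev, @norm_sub_sq ℂ, LinearIsometry.norm_map, h1]
  simp only [RCLike.re_to_complex, Complex.re_mul_ofReal]
  simp only [Complex.sub_re, Complex.one_re] at h2
  nlinarith [mul_le_mul_of_nonneg_left h2 (sq_nonneg ‖szego w‖)]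

lemma exists_finset_mul (F : Finset S) : ∃ T : Hardy →ₗᵢ[ℂ] Hardy,
    (∀ f z, hardyFun (T f) z = (∏ ζ ∈ F, blaschkeFactor ζ z) * hardyFun f z) ∧
    (∀ f, (∀ ζ ∈ F, hardyFun f ζ = 0) → ∃ h, T h = f) ∧
    ∀ f, ‖T f - f‖ ≤ ∑ ζ ∈ F, ‖factorMul ζ f - f‖ := by
  classical
  induction F using Finset.induction_on with
  | empty => exact ⟨LinearIsometry.id, by simp, fun f _ => ⟨f, rfl⟩, by simp⟩
  | insert ζ F hζ ih =>
    obtain ⟨T, h1, h2, h3⟩ := ih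
    refine ⟨(factorMul ζ).comp T, fun f z => ?_, fun f hf => ?_, fun f => ?_⟩
    · rw [LinearIsometry.coe_comp, Function.comp_apply, hardyFun_factorMul, h1,
        Finset.prod_insert hζ, mul_assoc]
    · obtain ⟨h, rfl⟩ := exists_factorMul_eq (hf ζ (Finset.mem_insert_self _ _))
      -- The factor at `ζ` vanishes only at `ζ`, so the quotient keeps all the other zeros.
      obtain ⟨g, rfl⟩ := h2 h fun ξ hξ => by
        have := hf ξ (Finset.mem_insert_of_mem hξ)
        rw [hardyFun_factorMul, mul_eq_zero, blaschkeFactor_eq_zero, Subtype.coe_inj] at this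
        exact this.resolve_left fun h => hζ (h ▸ hξ)
      exact ⟨g, rfl⟩
    · rw [Finset.sum_insert hζ, LinearIsometry.coe_comp, Function.comp_apply]
      calc ‖factorMul ζ (T f) - f‖
          = ‖(factorMul ζ f - f) + factorMul ζ (T f - f)‖ := by
            rw [map_sub]
            congr 1
            abel
        _ ≤ ‖factorMul ζ f - f‖ + ‖factorMul ζ (T f - f)‖ := norm_add_le _ _
        _ ≤ _ := by
          rw [LinearIsometry.norm_map]
          gcongr
          exact h3 f

/-- Multiplication by a finite Blaschke product. -/
def finsetMul (F : Finset S) : Hardy →ₗᵢ[ℂ] Hardy := (exists_finset_mul F).choose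

lemma hardyFun_finsetMul (F : Finset S) (f : Hardy) (z : 𝔻) :
    hardyFun (finsetMul F f) z = (∏ ζ ∈ F, blaschkeFactor ζ z) * hardyFun f z :=
  (exists_finset_mul F).choose_spec.1 f z

lemma exists_finsetMul_eq {F : Finset S} {f : Hardy} (hf : ∀ ζ ∈ F, hardyFun f ζ = 0) :
    ∃ h, finsetMul F h = f :=
  (exists_finset_mul F).choose_spec.2.1 f hf

lemma norm_finsetMul_sub_le (F : Finset S) (f : Hardy) :
    ‖finsetMul F f - f‖ ≤ ∑ ζ ∈ F, ‖factorMul ζ f - f‖ :=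
  (exists_finset_mul F).choose_spec.2.2 f

lemma cauchySeq_finsetMul_of_summable {f : Hardy}
    (hf : Summable fun ζ : S => ‖factorMul ζ f - f‖) :
    CauchySeq fun F : Finset S => finsetMul F f := by
  classical
  refine Metric.cauchySeq_iff'.mpr fun ε hε => ?_
  obtain ⟨F, hF⟩ := summable_iff_vanishing_norm.mp hf ε hε
  refine ⟨F, fun G hG => ?_⟩
  -- As multiplication over `F` is isometric, the distance to be bounded is that of `finsetMul (G \
  -- F) f` from `f`, a tail of the series.
  have h1 : finsetMul G f = finsetMul F (finsetMul (G \ F) f) := hardyFun_ext fun z => by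
    rw [hardyFun_finsetMul, hardyFun_finsetMul, hardyFun_finsetMul, ← mul_assoc,
      mul_comm (∏ _ ∈ F, _), Finset.prod_sdiff hG]
  rw [h1, dist_eq_norm, ← map_sub, LinearIsometry.norm_map]
  refine (norm_finsetMul_sub_le _ _).trans_lt ((le_abs_self _).trans_lt ?_)
  exact hF _ Finset.sdiff_disjoint

lemma dense_span_szego : Dense (Submodule.span ℂ (Set.range szego) : Set Hardy) := by
  rw [Submodule.dense_iff_topologicalClosure_eq_top,
    Submodule.topologicalClosure_eq_top_iff, Submodule.eq_bot_iff]
  intro f hf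
  refine hardyFun_eq_zero fun z => ?_
  rw [← inner_szego]
  exact hf _ (Submodule.subset_span ⟨z, rfl⟩)

lemma exists_tendsto_finsetMul_of_mem_span (hS : Summable fun ζ : S => √(1 - ‖(ζ : ℂ)‖))
    {g : Hardy} (hg : g ∈ Submodule.span ℂ (Set.range szego)) :
    ∃ l, Tendsto (fun F : Finset S => finsetMul F g) atTop (𝓝 l) := by
  induction hg using Submodule.span_induction with
  | mem g hg =>
    obtain ⟨w, rfl⟩ := hg
    exact cauchySeq_tendsto_of_complete <| cauchySeq_finsetMul_of_summable <|
      (hS.mul_left _).of_nonneg_of_le (fun _ => norm_nonneg _)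
        fun ζ => norm_factorMul_szego_sub_le ζ w
  | zero => exact ⟨0, by simp⟩
  | add g h _ _ hg hh =>
    obtain ⟨l, hl⟩ := hg
    obtain ⟨m, hm⟩ := hh
    exact ⟨l + m, by simpa only [map_add] using hl.add hm⟩
  | smul c g _ hg =>
    obtain ⟨l, hl⟩ := hg
    exact ⟨c • l, by simpa only [map_smul] using hl.const_smul c⟩

/-- The partial products are isometries, hence equicontinuous, so convergence passes from the dense
span of the Szegő functions to all of `H²`. -/
lemma cauchySeq_finsetMul (hS : Summable fun ζ : S => √(1 - ‖(ζ : ℂ)‖)) (f : Hardy) :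
    CauchySeq fun F : Finset S => finsetMul F f := by
  classical
  refine Metric.cauchySeq_iff'.mpr fun ε hε => ?_
  have hε3 : 0 < ε / 3 := by positivity
  obtain ⟨g, hg, hfg⟩ := dense_span_szego.exists_dist_lt f hε3
  obtain ⟨l, hl⟩ := exists_tendsto_finsetMul_of_mem_span hS hg
  obtain ⟨F, hF⟩ := Metric.cauchySeq_iff'.mp hl.cauchySeq (ε / 3) hε3
  refine ⟨F, fun G hG => ?_⟩
  have h1 : dist (finsetMul G f) (finsetMul G g) < ε / 3 := by rwa [LinearIsometry.dist_map]
  have h2 : dist (finsetMul F g) (finsetMul F f) < ε / 3 := by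
    rwa [LinearIsometry.dist_map, dist_comm]
  have h3 := hF G hG
  have h4 := dist_triangle4 (finsetMul G f) (finsetMul G g) (finsetMul F g) (finsetMul F f)
  linarith

lemma exists_blaschkeMul (hS : Summable fun ζ : S => √(1 - ‖(ζ : ℂ)‖)) :
    ∃ T : Hardy →ₗᵢ[ℂ] Hardy, ∀ f, Tendsto (fun F : Finset S => finsetMul F f) atTop (𝓝 (T f)) := by
  choose T hT using fun f => cauchySeq_tendsto_of_complete (cauchySeq_finsetMul hS f)
  refine ⟨⟨⟨⟨T, fun f g => ?_⟩, fun c f => ?_⟩, fun f => ?_⟩, hT⟩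
  · refine tendsto_nhds_unique (hT _) ?_
    simpa only [map_add] using (hT f).add (hT g)
  · refine tendsto_nhds_unique (hT _) ?_
    simpa only [map_smul, RingHom.id_apply] using (hT f).const_smul c
  · refine tendsto_nhds_unique (hT _).norm ?_
    simpa only [LinearIsometry.norm_map] using tendsto_const_nhds

/-- A Blaschke product acts on the Hardy space by an isometric multiplication operator, and every
function vanishing at its zeros is divisible by it. -/
lemma exists_isometry_mul_blaschkeProduct (hS : Summable fun ζ : S => √(1 - ‖(ζ : ℂ)‖)) :
    ∃ T : Hardy →ₗᵢ[ℂ] Hardy,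
      (∀ f z, hardyFun (T f) z = blaschkeProduct S z * hardyFun f z) ∧
      ∀ f, (∀ ζ ∈ S, hardyFun f ζ = 0) → ∃ h, T h = f := by
  obtain ⟨T, hT⟩ := exists_blaschkeMul hS
  have hmul : ∀ f z, hardyFun (T f) z = blaschkeProduct S z * hardyFun f z := fun f z => by
    refine tendsto_nhds_unique (tendsto_hardyFun (hT f) z) ?_
    simp only [hardyFun_finsetMul]
    exact (tendsto_blaschkeProduct hS z).mul_const _
  refine ⟨T, hmul, fun f hf => ?_⟩
  -- The partial quotients `h F` converge pointwise to `T* f`: by isometry `h F (w)` is the inner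
  -- product of `finsetMul F (szego w)` with `f`, and its first argument tends to `T (szego w)`.
  choose h hh using fun F : Finset S => exists_finsetMul_eq (F := F) (f := f) fun ζ _ => hf ζ ζ.2
  refine ⟨T.toContinuousLinearMap.adjoint f, hardyFun_ext fun w => ?_⟩
  have h1 : Tendsto (fun F => hardyFun (h F) w) atTop
      (𝓝 (hardyFun (T.toContinuousLinearMap.adjoint f) w)) := by
    rw [← inner_szego, ContinuousLinearMap.adjoint_inner_right]
    have h2 : ∀ F, hardyFun (h F) w = inner ℂ (finsetMul F (szego w)) f := fun F => by
      conv_rhs => rw [← hh F]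
      rw [LinearIsometry.inner_map_map, inner_szego]
    simp only [h2]
    exact (hT (szego w)).inner tendsto_const_nhds
  rw [hmul]
  refine tendsto_nhds_unique ((tendsto_blaschkeProduct hS w).mul h1) ?_
  refine tendsto_const_nhds.congr fun F => ?_
  rw [← hardyFun_finsetMul, hh]

end

section

/-! ### Holomorphic functions on the disc -/

/-- Holomorphic functions on the disc. -/
def IsHolo (f : 𝔻 → ℂ) : Prop :=
  ∃ g : ℂ → ℂ, DifferentiableOn ℂ g (Metric.ball 0 1) ∧ ∀ z : 𝔻, f z = g z

lemma mem_ball_coe (z : 𝔻) : (z : ℂ) ∈ Metric.ball (0 : ℂ) 1 := by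
  simpa using z.norm_lt_one

lemma IsHolo.sub {f g : 𝔻 → ℂ} (hf : IsHolo f) (hg : IsHolo g) : IsHolo (f - g) := by
  obtain ⟨F, hF, h⟩ := hf
  obtain ⟨G, hG, h'⟩ := hg
  exact ⟨F - G, hF.sub hG, fun z => by simp [h, h']⟩

lemma IsHolo.mul {f g : 𝔻 → ℂ} (hf : IsHolo f) (hg : IsHolo g) : IsHolo (f * g) := by
  obtain ⟨F, hF, h⟩ := hf
  obtain ⟨G, hG, h'⟩ := hg
  exact ⟨F * G, hF.mul hG, fun z => by simp [h, h']⟩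

lemma IsHolo.neg {f : 𝔻 → ℂ} (hf : IsHolo f) : IsHolo (-f) := by
  obtain ⟨F, hF, h⟩ := hf
  exact ⟨-F, hF.neg, fun z => by simp [h]⟩

lemma isHolo_sum {ι : Type*} (s : Finset ι) {f : ι → 𝔻 → ℂ} (hf : ∀ i ∈ s, IsHolo (f i)) :
    IsHolo fun z => ∑ i ∈ s, f i z := by
  choose! F hF h using hf
  exact ⟨fun z => ∑ i ∈ s, F i z, DifferentiableOn.fun_sum fun i hi => hF i hi,
    fun z => Finset.sum_congr rfl fun i hi => h i hi z⟩

lemma IsHolo.comp {f : 𝔻 → ℂ} (hf : IsHolo f) {φ : 𝔻 → 𝔻} (hφ : IsHolo fun z => (φ z : ℂ)) :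
    IsHolo (f ∘ φ) := by
  obtain ⟨F, hF, h⟩ := hf
  obtain ⟨G, hG, h'⟩ := hφ
  refine ⟨F ∘ G, hF.comp hG fun w hw => ?_, fun z => by simp [h, h']⟩
  have hw' : ‖w‖ < 1 := by simpa using hw
  have := h' (.mk w hw')
  rw [Complex.UnitDisc.coe_mk] at this
  rw [← this]
  exact mem_ball_coe _

lemma IsHolo.eq_zero_or_eq_zero {f g : 𝔻 → ℂ} (hf : IsHolo f) (hg : IsHolo g)
    (h : ∀ z, f z * g z = 0) : (∀ z, f z = 0) ∨ ∀ z, g z = 0 := by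
  obtain ⟨F, hF, h1⟩ := hf
  obtain ⟨G, hG, h2⟩ := hg
  have key := AnalyticOnNhd.eq_zero_or_eq_zero_of_mul_eq_zero
    (hF.analyticOnNhd Metric.isOpen_ball) (hG.analyticOnNhd Metric.isOpen_ball)
    (fun w hw => by
      have hw' : ‖w‖ < 1 := by simpa using hw
      have := h (.mk w hw')
      rwa [h1, h2, Complex.UnitDisc.coe_mk] at this)
    (convex_ball (0 : ℂ) 1).isPreconnected
  refine key.imp (fun k z => ?_) fun k z => ?_
  · rw [h1, k _ (mem_ball_coe z)]
  · rw [h2, k _ (mem_ball_coe z)]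

lemma isHolo_hardyFun (f : Hardy) : IsHolo (hardyFun f) := by
  refine ⟨fun z => ∑' n, f n * z ^ n, fun z hz => ?_, fun z => rfl⟩
  obtain ⟨r, hzr, hr⟩ := exists_between (show ‖z‖ < 1 by simpa using hz)
  have hr0 : 0 ≤ r := (norm_nonneg z).trans hzr.le
  have h := Complex.differentiableOn_tsum_of_summable_norm (u := fun n => ‖f‖ * r ^ n)
    (F := fun n z => f n * z ^ n) (U := Metric.ball (0 : ℂ) r)
    ((summable_geometric_of_lt_one hr0 hr).mul_left _) (fun n => by fun_prop) Metric.isOpen_ball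
    fun n w hw => by
      have hw' : ‖w‖ < r := by simpa using hw
      rw [norm_mul, norm_pow]
      gcongr
      exact lp.norm_apply_le_norm (by norm_num) f n
  have hz' : Metric.ball (0 : ℂ) r ∈ 𝓝 z := Metric.isOpen_ball.mem_nhds (by simpa using hzr)
  exact (h.differentiableAt hz').differentiableWithinAt

lemma isHolo_neg : IsHolo fun z : 𝔻 => ((Equiv.neg 𝔻 z : 𝔻) : ℂ) :=
  ⟨fun z => -z, by fun_prop, fun z => by simp⟩

lemma coe_involution (a z : 𝔻) :
    (involution a z : ℂ) = ((a : ℂ) - z) / (1 - conj (a : ℂ) * z) := rfl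

lemma isHolo_involution (a : 𝔻) : IsHolo fun z : 𝔻 => (involution a z : ℂ) := by
  refine ⟨fun z => ((a : ℂ) - z) / (1 - conj (a : ℂ) * z), ?_, fun z => coe_involution a z⟩
  refine DifferentiableOn.div (by fun_prop) (by fun_prop) fun w hw => ?_
  have hw' : ‖w‖ < 1 := by simpa using hw
  exact one_sub_conj_mul_ne_zero a (.mk w hw')

/-! ### The orbit of the origin -/

lemma ratio_pos (a : ℝ) (ha : a ∈ Set.Ioo (0 : ℝ) 1) : 0 < (1 - a) / (1 + a) :=
  div_pos (sub_pos.mpr ha.2) (by linarith [ha.1])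

lemma ratio_lt_one (a : ℝ) (ha : a ∈ Set.Ioo (0 : ℝ) 1) : (1 - a) / (1 + a) < 1 := by
  rw [div_lt_one (by linarith [ha.1])]
  linarith [ha.1]

lemma norm_orbitPoint_lt_one (a : ℝ) (ha : a ∈ Set.Ioo (0 : ℝ) 1) (n : ℤ) :
    ‖((((1 - a) / (1 + a)) ^ n - 1) / (((1 - a) / (1 + a)) ^ n + 1) : ℝ)‖ < 1 := by
  have := zpow_pos (ratio_pos a ha) n
  rw [norm_div, Real.norm_of_nonneg (by positivity : 0 ≤ ((1 - a) / (1 + a)) ^ n + 1),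
    div_lt_one (by positivity), Real.norm_eq_abs, abs_lt]
  constructor <;> linarith

variable (a : ℝ) (ha : a ∈ Set.Ioo (0 : ℝ) 1)

/-- The points of the orbit of the origin. -/
def orbitPoint (n : ℤ) : 𝔻 :=
  .mk (((((1 - a) / (1 + a)) ^ n - 1) / (((1 - a) / (1 + a)) ^ n + 1) : ℝ) : ℂ)
    ((Complex.norm_real _).trans_lt (norm_orbitPoint_lt_one a ha n))

lemma coe_orbitPoint (n : ℤ) : (orbitPoint a ha n : ℂ) =
    (((((1 - a) / (1 + a)) ^ n - 1) / (((1 - a) / (1 + a)) ^ n + 1) : ℝ) : ℂ) := rfl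

lemma orbitPoint_zero : orbitPoint a ha 0 = 0 := by
  apply Complex.UnitDisc.coe_injective
  simp [coe_orbitPoint]

lemma conj_orbitPoint (n : ℤ) : conj (orbitPoint a ha n : ℂ) = orbitPoint a ha n := by
  rw [coe_orbitPoint, Complex.conj_ofReal]

lemma neg_orbitPoint (n : ℤ) : -orbitPoint a ha n = orbitPoint a ha (-n) := by
  apply Complex.UnitDisc.coe_injective
  have := zpow_pos (ratio_pos a ha) n
  rw [Complex.UnitDisc.coe_neg, coe_orbitPoint, coe_orbitPoint, ← Complex.ofReal_neg, zpow_neg]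
  congr 1
  field_simp
  ring

/-- In the coordinate `t = (1 + z) / (1 - z)` the `n`-th orbit point is `t = q ^ n`, with `q = (1 -
a) / (1 + a)`, and the translation multiplies `t` by `q`. -/
lemma translation_orbitPoint (n : ℤ) :
    translation a ha (orbitPoint a ha n) = orbitPoint a ha (n + 1) := by
  apply Complex.UnitDisc.coe_injective
  have hp := ratio_pos a ha
  have h1 := zpow_pos hp n
  have ha0 := ha.1
  have ha1 := ha.2
  rw [translation_apply, coe_orbitPoint, coe_orbitPoint, zpow_add₀ hp.ne', zpow_one]
  norm_cast
  set t := ((1 - a) / (1 + a)) ^ n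
  have h2 : 0 < t * (1 - a) + (1 + a) := by nlinarith
  have h3 : 1 - a * ((t - 1) / (t + 1)) = (t * (1 - a) + (1 + a)) / (t + 1) := by
    field_simp
    ring
  have h4 : t * ((1 - a) / (1 + a)) + 1 = (t * (1 - a) + (1 + a)) / (1 + a) := by
    field_simp
  rw [h3, h4]
  field_simp
  ring

lemma involution_apply_eq_neg (z : 𝔻) :
    involution (realPoint a ha) z = -translation a ha z := by
  simp [translation]

lemma involution_orbitPoint (n : ℤ) :
    involution (realPoint a ha) (orbitPoint a ha n) = orbitPoint a ha (-(n + 1)) := by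
  rw [involution_apply_eq_neg, translation_orbitPoint, neg_orbitPoint]

lemma translation_zpow_zero (n : ℤ) : (translation a ha ^ n) 0 = orbitPoint a ha n := by
  induction n using Int.induction_on with
  | zero => rw [zpow_zero, orbitPoint_zero, Equiv.Perm.one_apply]
  | succ n ih =>
    rw [add_comm, zpow_one_add, Equiv.Perm.mul_apply, ih, translation_orbitPoint, add_comm]
  | pred n ih =>
    rw [sub_eq_add_neg, add_comm, zpow_add, zpow_neg_one, Equiv.Perm.mul_apply, ih,
      Equiv.Perm.inv_eq_iff_eq, translation_orbitPoint]
    congr 1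
    ring

lemma orbit_Gamma1 : MulAction.orbit (Gamma1 a ha) (0 : 𝔻) = Set.range (orbitPoint a ha) := by
  ext z
  constructor
  · rintro ⟨⟨γ, n, rfl⟩, rfl⟩
    exact ⟨n, (translation_zpow_zero a ha n).symm⟩
  · rintro ⟨n, rfl⟩
    exact ⟨⟨translation a ha ^ n, n, rfl⟩, translation_zpow_zero a ha n⟩

lemma neg_mem_Gamma2 : Equiv.neg 𝔻 ∈ Gamma2 a ha :=
  Subgroup.subset_closure (Set.mem_insert _ _)

lemma involution_mem_Gamma2 : involution (realPoint a ha) ∈ Gamma2 a ha :=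
  Subgroup.subset_closure (Set.mem_insert_of_mem _ rfl)

/-- A function is `Γ₂`-invariant once it is invariant under the two generators. -/
lemma invariant_of_generators {X : Type*} {f : 𝔻 → X} (h1 : ∀ z, f (-z) = f z)
    (h2 : ∀ z, f (involution (realPoint a ha) z) = f z) {γ : Equiv.Perm 𝔻} (hγ : γ ∈ Gamma2 a ha)
    (z : 𝔻) : f (γ z) = f z := by
  induction hγ using Subgroup.closure_induction generalizing z with
  | mem γ h =>
    rcases h with rfl | rfl
    · exact h1 z
    · exact h2 z
  | one => rfl
  | mul γ δ _ _ hγ hδ => rw [Equiv.Perm.mul_apply, hγ, hδ]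
  | inv γ _ hγ => rw [← hγ, ← Equiv.Perm.mul_apply, mul_inv_cancel, Equiv.Perm.one_apply]

lemma neg_mem_range_orbitPoint {z : 𝔻} (hz : z ∈ Set.range (orbitPoint a ha)) :
    -z ∈ Set.range (orbitPoint a ha) := by
  obtain ⟨n, rfl⟩ := hz
  exact ⟨_, (neg_orbitPoint a ha n).symm⟩

lemma involution_mem_range_orbitPoint {z : 𝔻} (hz : z ∈ Set.range (orbitPoint a ha)) :
    involution (realPoint a ha) z ∈ Set.range (orbitPoint a ha) := by
  obtain ⟨n, rfl⟩ := hz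
  exact ⟨_, (involution_orbitPoint a ha n).symm⟩

lemma involution_involution (b z : 𝔻) : involution b (involution b z) = z :=
  involutionFun_involutive b z

lemma orbit_Gamma2 : MulAction.orbit (Gamma2 a ha) (0 : 𝔻) = Set.range (orbitPoint a ha) := by
  refine Set.Subset.antisymm ?_ ?_
  · rintro _ ⟨⟨γ, hγ⟩, rfl⟩
    -- Membership in the set of orbit points is treated as a `Prop`-valued invariant function.
    have := invariant_of_generators a ha (f := fun z => z ∈ Set.range (orbitPoint a ha))
      (fun z => propext ⟨fun h => neg_neg z ▸ neg_mem_range_orbitPoint a ha h,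
        neg_mem_range_orbitPoint a ha⟩)
      (fun z => propext ⟨fun h => involution_involution (realPoint a ha) z ▸
        involution_mem_range_orbitPoint a ha h, involution_mem_range_orbitPoint a ha⟩) hγ 0
    exact this.mpr ⟨0, orbitPoint_zero a ha⟩
  · rw [← orbit_Gamma1]
    rintro _ ⟨⟨γ, n, rfl⟩, rfl⟩
    exact ⟨⟨_, zpow_mem (mul_mem (neg_mem_Gamma2 a ha) (involution_mem_Gamma2 a ha)) n⟩, rfl⟩

/-- With `t = q ^ n ≤ 1` one has `1 - |ζ| = 2 t / (t + 1) ≤ 2 t`. -/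
lemma one_sub_norm_orbitPoint_le (n : ℕ) :
    √(1 - ‖(orbitPoint a ha n : ℂ)‖) ≤ √2 * √((1 - a) / (1 + a)) ^ n := by
  have hp := ratio_pos a ha
  have h1 := pow_pos hp n
  have h2 := pow_le_one₀ hp.le (ratio_lt_one a ha).le (n := n)
  rw [Real.sqrt_le_left (by positivity), coe_orbitPoint, Complex.norm_real, zpow_natCast, mul_pow,
    ← pow_mul, mul_comm n, pow_mul, Real.sq_sqrt zero_le_two, Real.sq_sqrt hp.le, norm_div,
    Real.norm_of_nonpos (by linarith), Real.norm_of_nonneg (by positivity)]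
  set t := ((1 - a) / (1 + a)) ^ n
  have h3 : 1 - -(t - 1) / (t + 1) = 2 * t / (t + 1) := by
    field_simp
    ring
  rw [h3, div_le_iff₀ (by positivity)]
  nlinarith

lemma summable_range_orbitPoint :
    Summable fun ζ : Set.range (orbitPoint a ha) => √(1 - ‖((ζ : 𝔻) : ℂ)‖) := by
  have hg : Summable fun n : ℕ => √2 * √((1 - a) / (1 + a)) ^ n := by
    refine (summable_geometric_of_lt_one (Real.sqrt_nonneg _) ?_).mul_left _
    rw [Real.sqrt_lt' one_pos, one_pow]
    exact ratio_lt_one a ha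
  have h1 : Summable fun n : ℕ => √(1 - ‖(orbitPoint a ha n : ℂ)‖) :=
    hg.of_nonneg_of_le (fun _ => Real.sqrt_nonneg _) (one_sub_norm_orbitPoint_le a ha)
  have h2 : Summable fun n : ℤ => √(1 - ‖(orbitPoint a ha n : ℂ)‖) := by
    refine Summable.of_nat_of_neg h1 (h1.congr fun n => ?_)
    rw [← neg_orbitPoint, Complex.UnitDisc.coe_neg, norm_neg]
  -- A choice of index for each orbit point is automatically injective, so injectivity of
  -- `orbitPoint` is not needed.
  choose s hs using fun ζ : Set.range (orbitPoint a ha) => ζ.2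
  have h3 : Function.Injective s := fun ζ ξ h => Subtype.ext (by rw [← hs, ← hs, h])
  refine (h2.comp_injective h3).congr fun ζ => ?_
  rw [Function.comp_apply, hs]

end

section

/-! ### Invariance of the square of the Blaschke product -/

/-- For real `ζ ≠ 0` the normalising constant is `±1` and disappears on squaring; so does the sign
at `ζ = 0`. -/
lemma blaschkeFactor_sq {ζ : 𝔻} (hζ : conj (ζ : ℂ) = ζ) (z : 𝔻) :
    blaschkeFactor ζ z ^ 2 = (((ζ : ℂ) - z) / (1 - ζ * z)) ^ 2 := by
  by_cases h : ζ = 0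
  · simp [blaschkeFactor, h]
  · have h' : (ζ : ℂ) ≠ 0 := by simpa using h
    have h1 : (‖(ζ : ℂ)‖ : ℂ) ^ 2 = (ζ : ℂ) ^ 2 := by
      have := Complex.mul_conj (ζ : ℂ)
      rw [hζ, Complex.normSq_eq_norm_sq] at this
      rw [sq (ζ : ℂ), this]
      push_cast
      rfl
    rw [blaschkeFactor, if_neg h, mul_pow, div_pow, h1, div_self (pow_ne_zero _ h'), one_mul, hζ]

open scoped Classical in
-- Only the factor at the origin changes sign, which makes the orbit product odd.
lemma blaschkeFactor_neg (ζ z : 𝔻) :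
    blaschkeFactor ζ (-z) = (if ζ = 0 then -1 else 1) * blaschkeFactor (-ζ) z := by
  by_cases h : ζ = 0
  · simp [blaschkeFactor, h]
  · have h' : -ζ ≠ 0 := fun h' => h (by rw [← neg_neg ζ, h', neg_zero])
    rw [blaschkeFactor, blaschkeFactor, if_neg h, if_neg h', if_neg h, one_mul,
      Complex.UnitDisc.coe_neg, Complex.UnitDisc.coe_neg, norm_neg, map_neg, mul_neg, neg_mul,
      div_neg, ← neg_add', neg_div, neg_mul_neg, sub_neg_eq_add]

/-- An involution can be moved from one argument of the pseudo-hyperbolic quotient to the other at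
the cost of a sign, which the square removes. -/
lemma sq_div_involution {ζ b : 𝔻} (hb : conj (b : ℂ) = b) (z : 𝔻) :
    (((ζ : ℂ) - involution b z) / (1 - ζ * involution b z)) ^ 2 =
      (((involution b ζ : ℂ) - z) / (1 - involution b ζ * z)) ^ 2 := by
  have h1 := one_sub_conj_mul_ne_zero b z
  have h2 := one_sub_conj_mul_ne_zero b ζ
  rw [hb] at h1 h2
  rw [coe_involution, coe_involution, hb]
  have e1 : (ζ : ℂ) - (b - z) / (1 - b * z) = -((b - ζ) - z * (1 - b * ζ)) / (1 - b * z) := by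
    field_simp
    ring
  have e2 : 1 - (ζ : ℂ) * ((b - z) / (1 - b * z)) =
      ((1 - b * ζ) - (b - ζ) * z) / (1 - b * z) := by
    field_simp
    ring
  have e3 : ((b : ℂ) - ζ) / (1 - b * ζ) - z = ((b - ζ) - z * (1 - b * ζ)) / (1 - b * ζ) := by
    field_simp
  have e4 : 1 - ((b : ℂ) - ζ) / (1 - b * ζ) * z = ((1 - b * ζ) - (b - ζ) * z) / (1 - b * ζ) := by
    field_simp
  rw [e1, e2, e3, e4, div_div_div_cancel_right₀ h1, div_div_div_cancel_right₀ h2, neg_div, neg_sq]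

variable (a : ℝ) (ha : a ∈ Set.Ioo (0 : ℝ) 1)

/-- The Blaschke product of the orbit of the origin. -/
def orbitBlaschke (z : 𝔻) : ℂ := blaschkeProduct (Set.range (orbitPoint a ha)) z

lemma multipliable_orbit (z : 𝔻) :
    Multipliable fun ζ : Set.range (orbitPoint a ha) => blaschkeFactor ζ z :=
  multipliable_blaschkeFactor (summable_range_orbitPoint a ha) z

lemma norm_orbitBlaschke_lt_one (z : 𝔻) : ‖orbitBlaschke a ha z‖ < 1 :=
  (norm_blaschkeProduct_le (summable_range_orbitPoint a ha) ⟨0, orbitPoint_zero a ha⟩ z).trans_lt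
    z.norm_lt_one

lemma orbitBlaschke_zero : orbitBlaschke a ha 0 = 0 := by
  have := norm_blaschkeProduct_le (summable_range_orbitPoint a ha) ⟨0, orbitPoint_zero a ha⟩ 0
  rw [Complex.UnitDisc.coe_zero, norm_zero] at this
  exact norm_le_zero_iff.mp this

/-- Negation of the orbit. -/
def orbitNeg : Equiv.Perm (Set.range (orbitPoint a ha)) :=
  Function.Involutive.toPerm (fun ζ => ⟨-ζ, neg_mem_range_orbitPoint a ha ζ.2⟩)
    fun _ => Subtype.ext (neg_neg _)

/-- The action of the second generator on the orbit. -/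
def orbitInvolution : Equiv.Perm (Set.range (orbitPoint a ha)) :=
  Function.Involutive.toPerm
    (fun ζ => ⟨involution (realPoint a ha) ζ, involution_mem_range_orbitPoint a ha ζ.2⟩)
    fun _ => Subtype.ext (involution_involution _ _)

lemma orbitBlaschke_neg (z : 𝔻) : orbitBlaschke a ha (-z) = -orbitBlaschke a ha z := by
  classical
  set o : Set.range (orbitPoint a ha) := ⟨0, 0, orbitPoint_zero a ha⟩ with ho
  have h0 : ∀ ζ : Set.range (orbitPoint a ha),
      (if (ζ : 𝔻) = 0 then (-1 : ℂ) else 1) = if ζ = o then -1 else 1 := fun ζ => by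
    simp [ho, Subtype.ext_iff]
  have h1 : Multipliable fun ζ : Set.range (orbitPoint a ha) =>
      if ζ = o then (-1 : ℂ) else 1 :=
    multipliable_of_ne_finset_one (s := {o}) fun ζ hζ => if_neg (by simpa using hζ)
  have h2 : Multipliable fun ζ : Set.range (orbitPoint a ha) => blaschkeFactor (-ζ) z :=
    (orbitNeg a ha).multipliable_iff.mpr (multipliable_orbit a ha z)
  rw [orbitBlaschke, blaschkeProduct]
  simp only [blaschkeFactor_neg, h0]
  rw [h1.tprod_mul h2, tprod_ite_eq o fun _ => (-1 : ℂ), neg_one_mul]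
  exact congrArg Neg.neg ((orbitNeg a ha).tprod_eq fun ζ => blaschkeFactor ζ z)

/-- Squaring factor by factor removes the signs, after which the involution merely permutes the
zeros. -/
lemma orbitBlaschke_involution_sq (z : 𝔻) :
    orbitBlaschke a ha (involution (realPoint a ha) z) ^ 2 = orbitBlaschke a ha z ^ 2 := by
  have h : ∀ w, orbitBlaschke a ha w ^ 2 =
      ∏' ζ : Set.range (orbitPoint a ha), blaschkeFactor ζ w ^ 2 := fun w => by
    rw [sq, orbitBlaschke, blaschkeProduct,
      ← (multipliable_orbit a ha w).tprod_mul (multipliable_orbit a ha w)]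
    simp only [sq]
  have hreal : ∀ ζ ∈ Set.range (orbitPoint a ha), conj (ζ : ℂ) = ζ := by
    rintro _ ⟨n, rfl⟩
    exact conj_orbitPoint a ha n
  have ha' : conj (realPoint a ha : ℂ) = realPoint a ha := Complex.conj_ofReal a
  rw [h, h, ← (orbitInvolution a ha).tprod_eq fun ζ => blaschkeFactor ζ z ^ 2]
  refine tprod_congr fun ζ => ?_
  rw [blaschkeFactor_sq (hreal _ ζ.2), blaschkeFactor_sq (hreal _ (orbitInvolution a ha ζ).2),
    sq_div_involution ha']
  rfl

lemma orbitBlaschke_sq_invariant {γ : Equiv.Perm 𝔻} (hγ : γ ∈ Gamma2 a ha) (z : 𝔻) :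
    orbitBlaschke a ha (γ z) ^ 2 = orbitBlaschke a ha z ^ 2 :=
  invariant_of_generators a ha (f := fun z => orbitBlaschke a ha z ^ 2)
    (fun z => by rw [orbitBlaschke_neg, neg_sq]) (orbitBlaschke_involution_sq a ha) hγ z

/-! ### Division of invariant functions by the square of the Blaschke product -/

lemma exists_orbitMul : ∃ T : Hardy →ₗᵢ[ℂ] Hardy,
      (∀ f z, hardyFun (T f) z = orbitBlaschke a ha z * hardyFun f z) ∧
      ∀ f, (∀ ζ ∈ Set.range (orbitPoint a ha), hardyFun f ζ = 0) → ∃ h, T h = f :=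
  exists_isometry_mul_blaschkeProduct (summable_range_orbitPoint a ha)

lemma isHolo_orbitBlaschke : IsHolo (orbitBlaschke a ha) := by
  obtain ⟨T, hT, -⟩ := exists_orbitMul a ha
  convert isHolo_hardyFun (T (szego 0)) using 1
  ext z
  rw [hT, hardyFun_szego_zero, mul_one]

lemma eq_of_orbitBlaschke_mul_eq {f g : 𝔻 → ℂ} (hf : IsHolo f) (hg : IsHolo g)
    (h : ∀ z, orbitBlaschke a ha z * f z = orbitBlaschke a ha z * g z) (z : 𝔻) : f z = g z := by
  obtain ⟨T, hT, -⟩ := exists_orbitMul a ha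
  rcases (isHolo_orbitBlaschke a ha).eq_zero_or_eq_zero (hf.sub hg)
    (fun z => by rw [Pi.sub_apply, mul_sub, h, sub_self]) with h0 | h0
  -- The product is not identically zero, because multiplication by it preserves the norm of the
  -- constant `1`.
  · have h1 : T (szego 0) = 0 := hardyFun_eq_zero fun z => by rw [hT, h0, zero_mul]
    have h2 : szego 0 = 0 := by rwa [map_eq_zero_iff T T.injective] at h1
    have h3 := hardyFun_szego_zero z
    rw [h2, ← hardyEval_apply, map_zero] at h3
    exact absurd h3 zero_ne_one
  · exact sub_eq_zero.mp (h0 z)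

lemma eq_of_orbitBlaschke_sq_mul_eq {f g : 𝔻 → ℂ} (hf : IsHolo f) (hg : IsHolo g)
    (h : ∀ z, orbitBlaschke a ha z ^ 2 * f z = orbitBlaschke a ha z ^ 2 * g z) (z : 𝔻) :
    f z = g z := by
  refine eq_of_orbitBlaschke_mul_eq a ha hf hg (eq_of_orbitBlaschke_mul_eq a ha
    ((isHolo_orbitBlaschke a ha).mul hf) ((isHolo_orbitBlaschke a ha).mul hg) fun z => ?_) z
  simpa only [Pi.mul_apply, ← mul_assoc, ← sq] using h z

lemma exists_orbitPoint_eq (n : ℤ) : ∃ γ ∈ Gamma2 a ha, γ 0 = orbitPoint a ha n :=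
  ⟨translation a ha ^ n,
    zpow_mem (mul_mem (neg_mem_Gamma2 a ha) (involution_mem_Gamma2 a ha)) n,
    translation_zpow_zero a ha n⟩

/-- Multiplication by the square of the Blaschke product maps the invariant functions isometrically
onto the invariant functions vanishing at the origin. -/
lemma exists_orbitMul_sq : ∃ T : Hardy →ₗᵢ[ℂ] Hardy,
    (∀ f z, hardyFun (T f) z = orbitBlaschke a ha z ^ 2 * hardyFun f z) ∧
    ∀ f ∈ HTwo (Gamma2 a ha), hardyFun f 0 = 0 → ∃ h ∈ HTwo (Gamma2 a ha), T h = f := by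
  obtain ⟨T, hT, hdiv⟩ := exists_orbitMul a ha
  refine ⟨T.comp T, fun f z => ?_, fun f hf hf0 => ?_⟩
  · rw [LinearIsometry.coe_comp, Function.comp_apply, hT, hT, ← mul_assoc, sq]
  have hinv : ∀ γ ∈ Gamma2 a ha, ∀ z, hardyFun f (γ z) = hardyFun f z :=
    fun γ hγ z => congrFun (hf γ hγ) z
  obtain ⟨g, rfl⟩ := hdiv f (by
    rintro _ ⟨n, rfl⟩
    obtain ⟨γ, hγ, h⟩ := exists_orbitPoint_eq a ha n
    rw [← h, hinv γ hγ, hf0])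
  have hodd : ∀ z, hardyFun g (-z) = -hardyFun g z := by
    refine eq_of_orbitBlaschke_mul_eq a ha ((isHolo_hardyFun g).comp isHolo_neg)
      (isHolo_hardyFun g).neg fun z => ?_
    have h := hinv _ (neg_mem_Gamma2 a ha) z
    rw [hT, hT, Equiv.neg_apply, orbitBlaschke_neg] at h
    change orbitBlaschke a ha z * hardyFun g (-z) = orbitBlaschke a ha z * -hardyFun g z
    linear_combination -h
  have hg0 : hardyFun g 0 = 0 := by
    have h := hodd 0
    rw [neg_zero] at h
    exact self_eq_neg.mp h
  -- Under the involution `B` is controlled only up to sign, so only `g²` is shown invariant; this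
  -- suffices to carry the zero at the origin along the orbit.
  have hsq : ∀ z, hardyFun g (involution (realPoint a ha) z) ^ 2 = hardyFun g z ^ 2 := by
    have hg : IsHolo fun z => hardyFun g z ^ 2 := by
      convert (isHolo_hardyFun g).mul (isHolo_hardyFun g) using 1
      exact funext fun z => sq _
    refine eq_of_orbitBlaschke_sq_mul_eq a ha (hg.comp (isHolo_involution (realPoint a ha))) hg
      fun z => ?_
    have h := hinv _ (involution_mem_Gamma2 a ha) z
    rw [hT, hT] at h
    have h2 := congrArg (· ^ 2) h
    simp only [mul_pow, orbitBlaschke_involution_sq] at h2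
    exact h2
  obtain ⟨h, rfl⟩ := hdiv g (by
    rintro _ ⟨n, rfl⟩
    obtain ⟨γ, hγ, h⟩ := exists_orbitPoint_eq a ha n
    have := invariant_of_generators a ha (f := fun z => hardyFun g z ^ 2)
      (fun z => by rw [hodd, neg_sq]) hsq hγ 0
    rw [← h]
    simpa [hg0] using this)
  refine ⟨h, fun γ hγ => funext fun z => ?_, rfl⟩
  have hTT : ∀ z, hardyFun (T (T h)) z = orbitBlaschke a ha z ^ 2 * hardyFun h z := fun z => by
    rw [hT, hT, ← mul_assoc, sq]
  refine invariant_of_generators a ha (f := hardyFun h) ?_ ?_ hγ z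
  · refine eq_of_orbitBlaschke_sq_mul_eq a ha ((isHolo_hardyFun h).comp isHolo_neg)
      (isHolo_hardyFun h) fun z => ?_
    rw [← hTT, ← hinv _ (neg_mem_Gamma2 a ha), hTT, orbitBlaschke_sq_invariant a ha
      (neg_mem_Gamma2 a ha)]
    rfl
  · refine eq_of_orbitBlaschke_sq_mul_eq a ha
      ((isHolo_hardyFun h).comp (isHolo_involution (realPoint a ha))) (isHolo_hardyFun h)
      fun z => ?_
    rw [← hTT, ← hinv _ (involution_mem_Gamma2 a ha), hTT, orbitBlaschke_sq_invariant a ha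
      (involution_mem_Gamma2 a ha)]

/-! ### The reproducing kernel of the invariant functions -/

lemma szego_zero_mem_HTwo (Γ : Subgroup (Equiv.Perm 𝔻)) : szego 0 ∈ HTwo Γ :=
  fun γ _ => funext fun z => by simp [hardyFun_szego_zero]

/-- The kernel function of the invariant functions at `w`, as an element of the Hardy space. -/
def invSzego (Γ : Subgroup (Equiv.Perm 𝔻)) (w : 𝔻) : HTwo Γ := RKHS.kerFun (HTwo Γ) w 1

lemma inner_invSzego {Γ : Subgroup (Equiv.Perm 𝔻)} (w : 𝔻) {f : Hardy} (hf : f ∈ HTwo Γ) :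
    inner ℂ (invSzego Γ w : Hardy) f = hardyFun f w := by
  have h := RKHS.kerFun_inner w (1 : ℂ) (⟨f, hf⟩ : HTwo Γ)
  rw [HTwo_coe_apply] at h
  refine (h.trans ?_)
  simp

lemma invKernel_eq_hardyFun (Γ : Subgroup (Equiv.Perm 𝔻)) (z w : 𝔻) :
    invKernel Γ z w = hardyFun (invSzego Γ w) z := by
  rw [invKernel_eq, HTwo_coe_apply]
  rfl

lemma invSzego_eq {Γ : Subgroup (Equiv.Perm 𝔻)} {w : 𝔻} {g : Hardy} (hg : g ∈ HTwo Γ)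
    (h : ∀ f ∈ HTwo Γ, inner ℂ g f = hardyFun f w) : (invSzego Γ w : Hardy) = g := by
  refine sub_eq_zero.mp ?_
  have hm := (HTwo Γ).sub_mem (invSzego Γ w).2 hg
  rw [← inner_self_eq_zero (𝕜 := ℂ), inner_sub_left, inner_invSzego w hm, h _ hm, sub_self]

/-- Write an invariant `f` as `f(0) + B² h`. The constants are orthogonal to the multiples of `B²`,
so `1 + conj (B(w)²) B² k_w` pairs with `f` to give `f(0) + B(w)² h(w) = f(w)`. By uniqueness it
equals `k_w`, and evaluation at `z` is a linear equation for the kernel. -/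
theorem invKernel_Gamma2 (z w : 𝔻) : invKernel (Gamma2 a ha) z w =
    1 / (1 - orbitBlaschke a ha z ^ 2 * conj (orbitBlaschke a ha w ^ 2)) := by
  obtain ⟨T, hT, hdiv⟩ := exists_orbitMul_sq a ha
  set Γ := Gamma2 a ha
  have hmem : ∀ f ∈ HTwo Γ, T f ∈ HTwo Γ := fun f hf γ hγ => funext fun z => by
    rw [Function.comp_apply, hT, hT, orbitBlaschke_sq_invariant a ha hγ,
      show hardyFun f (γ z) = hardyFun f z from congrFun (hf γ hγ) z]
  have hT0 : ∀ f, hardyFun (T f) 0 = 0 := fun f => by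
    rw [hT, orbitBlaschke_zero]
    simp
  have hk : (invSzego Γ w : Hardy) =
      szego 0 + conj (orbitBlaschke a ha w ^ 2) • T (invSzego Γ w) := by
    refine invSzego_eq ((HTwo Γ).add_mem (szego_zero_mem_HTwo Γ)
      ((HTwo Γ).smul_mem _ (hmem _ (invSzego Γ w).2))) fun f hf => ?_
    have hm : f - hardyFun f 0 • szego 0 ∈ HTwo Γ :=
      (HTwo Γ).sub_mem hf ((HTwo Γ).smul_mem _ (szego_zero_mem_HTwo Γ))
    obtain ⟨h, hh, hTh⟩ := hdiv _ hm (by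
      rw [hardyFun_sub, hardyFun_smul, hardyFun_szego_zero, mul_one, sub_self])
    have hf' : f = hardyFun f 0 • szego 0 + T h := by rw [hTh]; abel
    have hw : hardyFun f w = hardyFun f 0 + orbitBlaschke a ha w ^ 2 * hardyFun h w := by
      conv_lhs => rw [hf']
      rw [hardyFun_add, hardyFun_smul, hardyFun_szego_zero, mul_one, hT]
    have h1 : inner ℂ (T (invSzego Γ w)) f = hardyFun h w := by
      conv_lhs => rw [hf']
      rw [inner_add_right, inner_smul_right, ← inner_conj_symm, inner_szego, hT0, map_zero,
        mul_zero, zero_add, LinearIsometry.inner_map_map, inner_invSzego w hh]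
    rw [inner_add_left, inner_smul_left, Complex.conj_conj, inner_szego, h1, hw]
  have hz : hardyFun (invSzego Γ w) z =
      1 + conj (orbitBlaschke a ha w ^ 2) *
        (orbitBlaschke a ha z ^ 2 * hardyFun (invSzego Γ w) z) := by
    conv_lhs => rw [hk]
    rw [hardyFun_add, hardyFun_smul, hT, hardyFun_szego_zero]
  have hne : 1 - orbitBlaschke a ha z ^ 2 * conj (orbitBlaschke a ha w ^ 2) ≠ 0 := by
    intro h
    have h1 := sub_eq_zero.mp h
    have h2 := congrArg norm h1
    rw [norm_one, norm_mul, RCLike.norm_conj, norm_pow, norm_pow] at h2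
    have h3 := pow_lt_one₀ (norm_nonneg _) (norm_orbitBlaschke_lt_one a ha z) two_ne_zero
    have h4 := pow_lt_one₀ (norm_nonneg _) (norm_orbitBlaschke_lt_one a ha w) two_ne_zero
    nlinarith [sq_nonneg ‖orbitBlaschke a ha z‖, sq_nonneg ‖orbitBlaschke a ha w‖]
  rw [invKernel_eq_hardyFun, eq_div_iff hne]
  linear_combination hz

end

/-! ### Bounded holomorphic multipliers -/

lemma sum_range_sq_eq_circleAverage (d : ℕ → ℂ) (N : ℕ) :
    ∑ n ∈ Finset.range N, ‖d n‖ ^ 2 =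
      Real.circleAverage (fun z => ‖∑ n ∈ Finset.range N, d n * z ^ n‖ ^ 2) 0 1 := by
  set p : Polynomial ℂ := ∑ n ∈ Finset.range N, Polynomial.monomial n (d n) with hp
  have hc : ∀ n, p.coeff n = if n < N then d n else 0 := fun n => by
    simp [hp, Polynomial.coeff_monomial]
  have h := p.sum_sq_norm_coeff_eq_circleAverage
  have he : ∀ z, p.eval z = ∑ n ∈ Finset.range N, d n * z ^ n := fun z => by
    simp [hp, Polynomial.eval_finsetSum]
  simp only [he] at h
  rw [← h]
  symm
  have hsub : p.support ⊆ Finset.range N := fun n hn => by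
    rw [Polynomial.mem_support_iff, hc] at hn
    exact Finset.mem_range.mpr (by_contra fun h => hn (if_neg h))
  rw [Finset.sum_subset hsub fun n _ hn => by
    rw [Polynomial.notMem_support_iff.mp hn]
    simp]
  refine Finset.sum_congr rfl fun n hn => ?_
  rw [hc, if_pos (Finset.mem_range.mp hn)]

/-- Parseval's identity, obtained from that for polynomials by dominated convergence. -/
lemma hasSum_sq_circleAverage {d : ℕ → ℂ} (hd : Summable fun n => ‖d n‖) :
    HasSum (fun n => ‖d n‖ ^ 2) (Real.circleAverage (fun z => ‖∑' n, d n * z ^ n‖ ^ 2) 0 1) := by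
  rw [hasSum_iff_tendsto_nat_of_nonneg fun _ => by positivity]
  simp only [sum_range_sq_eq_circleAverage, Real.circleAverage]
  refine Tendsto.const_smul ?_ _
  have hn : ∀ θ n, ‖d n * circleMap 0 1 θ ^ n‖ = ‖d n‖ := fun θ n => by simp
  refine intervalIntegral.tendsto_integral_filter_of_dominated_convergence
    (fun _ => (∑' n, ‖d n‖) ^ 2) (Eventually.of_forall fun N => ?_)
    (Eventually.of_forall fun N => Eventually.of_forall fun θ _ => ?_)
    intervalIntegrable_const (Eventually.of_forall fun θ _ => ?_)
  · have : Continuous fun θ => ‖∑ n ∈ Finset.range N, d n * circleMap 0 1 θ ^ n‖ ^ 2 := by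
      fun_prop
    exact this.aestronglyMeasurable
  · rw [norm_pow, norm_norm]
    gcongr
    refine (norm_sum_le _ _).trans ?_
    simp only [hn]
    exact hd.sum_le_tsum _ fun _ _ => norm_nonneg _
  · have hs : Summable fun n => d n * circleMap 0 1 θ ^ n :=
      Summable.of_norm (by simpa only [hn] using hd)
    exact (hs.hasSum.tendsto_sum_nat.norm).pow 2

lemma circleIntegrable_tsum_sq {d : ℕ → ℂ} (hd : Summable fun n => ‖d n‖) :
    CircleIntegrable (fun z => ‖∑' n, d n * z ^ n‖ ^ 2) 0 1 := by
  have : Continuous fun θ => ‖∑' n, d n * circleMap 0 1 θ ^ n‖ ^ 2 := by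
    refine ((continuous_tsum (fun n => by fun_prop) hd fun n θ => ?_).norm).pow 2
    simp
  exact this.intervalIntegrable _ _

lemma IsHolo.exists_hasSum {f : 𝔻 → ℂ} (hf : IsHolo f) :
    ∃ c : ℕ → ℂ, ∀ z : 𝔻, HasSum (fun n => c n * (z : ℂ) ^ n) (f z) := by
  obtain ⟨F, hF, h⟩ := hf
  refine ⟨fun n => ((n.factorial : ℂ))⁻¹ * iteratedDeriv n F 0, fun z => ?_⟩
  rw [h]
  have h2 := Complex.hasSum_taylorSeries_on_ball hF (mem_ball_coe z)
  simp only [sub_zero, smul_eq_mul] at h2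
  have h3 : ∀ n : ℕ, (n.factorial : ℂ)⁻¹ * iteratedDeriv n F 0 * (z : ℂ) ^ n =
      (n.factorial : ℂ)⁻¹ * ((z : ℂ) ^ n * iteratedDeriv n F 0) := fun n => by ring
  simp only [h3]
  exact h2

lemma hasSum_norm_sq (f : Hardy) : HasSum (fun n => ‖f n‖ ^ 2) (‖f‖ ^ 2) := by
  simpa using lp.hasSum_norm (by norm_num) f

lemma summable_norm_mul_pow {c : ℕ → ℂ} (hc : ∀ z : 𝔻, Summable fun n => c n * (z : ℂ) ^ n)
    {r : ℝ} (hr0 : 0 ≤ r) (hr : r < 1) : Summable fun n => ‖c n * (r : ℂ) ^ n‖ := by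
  have h : ‖(r : ℂ)‖ < 1 := by rwa [Complex.norm_real, Real.norm_of_nonneg hr0]
  exact (hc (.mk r h)).norm

/-- If a tuple of power series is dominated pointwise on the disc by a tuple of elements of the
Hardy space, then so are the sums of squares of the coefficients. -/
lemma sum_sq_coeff_le {ι κ : Type*} [Fintype ι] [Fintype κ] {c : ι → ℕ → ℂ} {f : ι → 𝔻 → ℂ}
    (hc : ∀ i (z : 𝔻), HasSum (fun n => c i n * (z : ℂ) ^ n) (f i z)) (v : κ → Hardy)
    (hfv : ∀ z, ∑ i, ‖f i z‖ ^ 2 ≤ ∑ j, ‖hardyFun (v j) z‖ ^ 2) (s : Finset ℕ) :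
    ∑ i, ∑ n ∈ s, ‖c i n‖ ^ 2 ≤ ∑ j, ‖v j‖ ^ 2 := by
  -- The domination is averaged over the circle of radius `r`, rescaled to the unit circle by
  -- replacing `c n` with `c n * r ^ n`. Letting `r → 1` at the end avoids boundary values.
  have key : ∀ r : ℝ, 0 < r → r < 1 →
      ∑ i, ∑ n ∈ s, ‖c i n‖ ^ 2 * (r ^ n) ^ 2 ≤ ∑ j, ‖v j‖ ^ 2 := by
    intro r hr0 hr
    have hmap : ∀ z ∈ Metric.sphere (0 : ℂ) |1|, ‖(r : ℂ) * z‖ < 1 := fun z hz => by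
      have : ‖z‖ = 1 := by simpa using hz
      rwa [norm_mul, this, mul_one, Complex.norm_real, Real.norm_of_nonneg hr0.le]
    have hcs := fun i => summable_norm_mul_pow (fun z => (hc i z).summable) hr0.le hr
    have hvs := fun j => summable_norm_mul_pow (fun z => (hardyFun_hasSum (v j) z).summable)
      hr0.le hr
    have hn : ∀ (x : ℂ) (n : ℕ), ‖x * (r : ℂ) ^ n‖ ^ 2 = ‖x‖ ^ 2 * (r ^ n) ^ 2 := fun x n => by
      rw [norm_mul, norm_pow, Complex.norm_real, Real.norm_of_nonneg hr0.le, mul_pow]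
    have h1 := fun i => hasSum_sq_circleAverage (hcs i)
    have h2 := fun j => hasSum_sq_circleAverage (hvs j)
    simp only [hn] at h1 h2
    calc ∑ i, ∑ n ∈ s, ‖c i n‖ ^ 2 * (r ^ n) ^ 2
        ≤ ∑ i, Real.circleAverage (fun z => ‖∑' n, c i n * (r : ℂ) ^ n * z ^ n‖ ^ 2) 0 1 :=
          Finset.sum_le_sum fun i _ => sum_le_hasSum s (fun _ _ => by positivity) (h1 i)
      _ = Real.circleAverage (fun z => ∑ i, ‖∑' n, c i n * (r : ℂ) ^ n * z ^ n‖ ^ 2) 0 1 :=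
          (Real.circleAverage_fun_sum fun i _ => circleIntegrable_tsum_sq (hcs i)).symm
      _ ≤ Real.circleAverage (fun z => ∑ j, ‖∑' n, v j n * (r : ℂ) ^ n * z ^ n‖ ^ 2) 0 1 := by
          refine Real.circleAverage_mono
            (CircleIntegrable.fun_sum _ fun i _ => circleIntegrable_tsum_sq (hcs i))
            (CircleIntegrable.fun_sum _ fun j _ => circleIntegrable_tsum_sq (hvs j)) fun z hz => ?_
          have h := hfv (.mk _ (hmap z hz))
          simp only [← (hc _ _).tsum_eq, hardyFun, Complex.UnitDisc.coe_mk, mul_pow,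
            ← mul_assoc] at h
          exact h
      _ = ∑ j, Real.circleAverage (fun z => ‖∑' n, v j n * (r : ℂ) ^ n * z ^ n‖ ^ 2) 0 1 :=
          Real.circleAverage_fun_sum fun j _ => circleIntegrable_tsum_sq (hvs j)
      _ ≤ ∑ j, ‖v j‖ ^ 2 := by
          refine Finset.sum_le_sum fun j _ => hasSum_le (fun n => ?_) (h2 j) (hasSum_norm_sq (v j))
          refine mul_le_of_le_one_right (by positivity) ?_
          exact pow_le_one₀ (by positivity) (pow_le_one₀ hr0.le hr.le)
  have hlim : Tendsto (fun r : ℝ => ∑ i, ∑ n ∈ s, ‖c i n‖ ^ 2 * (r ^ n) ^ 2) (𝓝[<] 1)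
      (𝓝 (∑ i, ∑ n ∈ s, ‖c i n‖ ^ 2 * ((1 : ℝ) ^ n) ^ 2)) := by
    refine Tendsto.mono_left ?_ nhdsWithin_le_nhds
    exact Continuous.tendsto (by fun_prop) 1
  simp only [one_pow, mul_one] at hlim
  refine le_of_tendsto hlim ?_
  filter_upwards [Ioo_mem_nhdsLT (zero_lt_one (α := ℝ))] with r hr
  exact key r hr.1 hr.2

/-- A tuple of holomorphic functions dominated pointwise by a tuple of elements of the Hardy space
consists of elements of the Hardy space, with the same domination of the norms. -/
lemma exists_hardy_of_dominated {ι κ : Type*} [Fintype ι] [Fintype κ] {f : ι → 𝔻 → ℂ}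
    (hf : ∀ i, IsHolo (f i)) (v : κ → Hardy)
    (hfv : ∀ z, ∑ i, ‖f i z‖ ^ 2 ≤ ∑ j, ‖hardyFun (v j) z‖ ^ 2) :
    ∃ w : ι → Hardy, (∀ i z, hardyFun (w i) z = f i z) ∧
      ∑ i, ‖w i‖ ^ 2 ≤ ∑ j, ‖v j‖ ^ 2 := by
  choose c hc using fun i => (hf i).exists_hasSum
  have key := sum_sq_coeff_le hc v hfv
  have hmem : ∀ i, Memℓp (c i) 2 := fun i => by
    refine memℓp_gen' (C := ∑ j, ‖v j‖ ^ 2) fun s => ?_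
    refine le_trans ?_ (key s)
    simpa using Finset.single_le_sum (f := fun i => ∑ n ∈ s, ‖c i n‖ ^ 2)
      (fun _ _ => by positivity) (Finset.mem_univ i)
  refine ⟨fun i => ⟨c i, hmem i⟩, fun i z => (hc i z).tsum_eq, ?_⟩
  refine le_of_tendsto (tendsto_finsetSum _ fun i _ => hasSum_norm_sq ⟨c i, hmem i⟩)
    (Eventually.of_forall key)

/-! ### Transfer functions -/

lemma norm_toLp_prod_sq {E M : Type*} [NormedAddCommGroup E] [NormedAddCommGroup M] (x : E) (y : M) :
    ‖WithLp.toLp 2 (x, y)‖ ^ 2 = ‖x‖ ^ 2 + ‖y‖ ^ 2 :=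
  WithLp.prod_norm_sq_eq_of_L2 _

lemma inner_toLp_prod {E M : Type*} [NormedAddCommGroup E] [InnerProductSpace ℂ E]
    [NormedAddCommGroup M] [InnerProductSpace ℂ M] (x x' : E) (y y' : M) :
    inner ℂ (WithLp.toLp 2 (x, y)) (WithLp.toLp 2 (x', y')) = inner ℂ x x' + inner ℂ y y' :=
  WithLp.prod_inner_apply _ _

/-- The transfer function of a contraction of `E × M`. -/
lemma exists_transfer {E M : Type*} [NormedAddCommGroup E] [InnerProductSpace ℂ E]
    [NormedAddCommGroup M] [InnerProductSpace ℂ M] [FiniteDimensional ℂ M]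
    (C : WithLp 2 (E × M) →L[ℂ] WithLp 2 (E × M)) (hC : ∀ p, ‖C p‖ ≤ ‖p‖) :
    ∃ G : ℂ → E →L[ℂ] E, DifferentiableOn ℂ G (Metric.ball 0 1) ∧
      ∀ t ∈ Metric.ball (0 : ℂ) 1, ∀ x, ∃ s : M,
        C (WithLp.toLp 2 (x, t • s)) = WithLp.toLp 2 (G t x, s) := by
  have : CompleteSpace M := FiniteDimensional.complete ℂ M
  let e : WithLp 2 (E × M) ≃L[ℂ] E × M := WithLp.prodContinuousLinearEquiv 2 ℂ E M
  let C' : E × M →L[ℂ] E × M := e.toContinuousLinearMap ∘L C ∘L e.symm.toContinuousLinearMap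
  let a := ContinuousLinearMap.fst ℂ E M ∘L C' ∘L ContinuousLinearMap.inl ℂ E M
  let b := ContinuousLinearMap.fst ℂ E M ∘L C' ∘L ContinuousLinearMap.inr ℂ E M
  let c := ContinuousLinearMap.snd ℂ E M ∘L C' ∘L ContinuousLinearMap.inl ℂ E M
  let d := ContinuousLinearMap.snd ℂ E M ∘L C' ∘L ContinuousLinearMap.inr ℂ E M
  have hC' : ∀ x y, C (WithLp.toLp 2 (x, y)) = WithLp.toLp 2 (a x + b y, c x + d y) := by
    intro x y
    have h1 : C (WithLp.toLp 2 (x, y)) = WithLp.toLp 2 (C' (x, y)) := rfl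
    have h2 : ((x, y) : E × M) = (x, 0) + (0, y) := by simp
    rw [h1, h2, map_add]
    rfl
  have hd : ‖d‖ ≤ 1 := by
    refine ContinuousLinearMap.opNorm_le_bound _ zero_le_one fun y => ?_
    have h2 := pow_le_pow_left₀ (norm_nonneg _) (hC (WithLp.toLp 2 (0, y))) 2
    rw [hC', norm_toLp_prod_sq, norm_toLp_prod_sq] at h2
    simp only [map_zero, zero_add, norm_zero] at h2
    rw [one_mul]
    refine le_of_sq_le_sq ?_ (norm_nonneg _)
    nlinarith [sq_nonneg ‖b y‖]
  have hunit : ∀ t ∈ Metric.ball (0 : ℂ) 1, IsUnit (1 - t • d) := fun t ht => by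
    refine isUnit_one_sub_of_norm_lt_one ?_
    rw [norm_smul]
    have : ‖t‖ < 1 := by simpa using ht
    nlinarith [norm_nonneg t]
  -- The state `s` solves `s = c x + t d s`, and the output is `a x + t b s`.
  refine ⟨fun t => a + t • (b ∘L Ring.inverse (1 - t • d) ∘L c), fun t ht => ?_,
    fun t ht x => ⟨Ring.inverse (1 - t • d) (c x), ?_⟩⟩
  · have h1 : DifferentiableAt ℂ (fun t : ℂ => Ring.inverse (1 - t • d)) t := by
      obtain ⟨u, hu⟩ := hunit t ht
      have h2 : DifferentiableAt ℂ Ring.inverse (1 - t • d) := by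
        rw [← hu]
        exact differentiableAt_inverse u.isUnit
      exact h2.comp t (f := fun t : ℂ => 1 - t • d) (by fun_prop)
    have h2 : DifferentiableAt ℂ (fun t : ℂ => b ∘L Ring.inverse (1 - t • d) ∘L c) t :=
      (differentiableAt_const b).clm_comp (h1.clm_comp (differentiableAt_const c))
    exact ((differentiableAt_const a).add (differentiableAt_id.smul h2)).differentiableWithinAt
  · set s := Ring.inverse (1 - t • d) (c x) with hs
    have h1 : s - t • d s = c x := by
      have := congrArg (fun A : M →L[ℂ] M => A (c x)) (Ring.mul_inverse_cancel _ (hunit t ht))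
      simpa using this
    rw [hC', map_smul, map_smul]
    congr 1
    refine Prod.ext ?_ ?_
    · simp [hs]
    · simp [← h1]

/-! ### Lurking isometries and interpolation -/

section Realization

variable {E M : Type*} [NormedAddCommGroup E] [InnerProductSpace ℂ E] [FiniteDimensional ℂ E]
  [NormedAddCommGroup M] [InnerProductSpace ℂ M] [FiniteDimensional ℂ M]

/-- Two linear maps with the same pointwise norms differ by a linear isometry of the target. -/
lemma exists_isometry_comp_eq {X : Type*} [AddCommGroup X] [Module ℂ X] (f g : X →ₗ[ℂ] E)
    (h : ∀ x, ‖f x‖ = ‖g x‖) : ∃ U : E →ₗᵢ[ℂ] E, ∀ x, U (f x) = g x := by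
  -- Equality of norms makes `f x ↦ g x` a well-defined isometry on the range of `f`; finite
  -- dimension lets it extend to `E`.
  have hker : LinearMap.ker f ≤ LinearMap.ker g := fun x hx => by
    rw [LinearMap.mem_ker] at hx ⊢
    rw [← norm_eq_zero, ← h, hx, norm_zero]
  set L : LinearMap.range f →ₗ[ℂ] E :=
    (LinearMap.ker f).liftQ g hker ∘ₗ f.quotKerEquivRange.symm.toLinearMap
  have hL : ∀ x, L ⟨f x, x, rfl⟩ = g x := fun x => by
    have : f.quotKerEquivRange.symm ⟨f x, x, rfl⟩ = (LinearMap.ker f).mkQ x :=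
      f.quotKerEquivRange_symm_apply_image x _
    simp only [L, LinearMap.comp_apply, LinearEquiv.coe_coe, this]
    exact Submodule.liftQ_apply _ _ _
  let L' : LinearMap.range f →ₗᵢ[ℂ] E := ⟨L, by
    rintro ⟨_, x, rfl⟩
    rw [hL, ← h]
    rfl⟩
  exact ⟨L'.extend, fun x => (L'.extend_apply ⟨f x, x, rfl⟩).trans (hL x)⟩

/-- The solution of an interpolation problem by a transfer function. -/
lemma exists_interpolant {ι : Type*} [Fintype ι] (t : ι → ℂ) (ht : ∀ i, ‖t i‖ < 1)
    (W : ι → E →ₗ[ℂ] E) (V : ι → E →ₗ[ℂ] M)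
    (h : ∀ i j x y, inner ℂ x y + t i * conj (t j) * inner ℂ (V i x) (V j y) =
      inner ℂ (W i x) (W j y) + inner ℂ (V i x) (V j y)) :
    ∃ G : ℂ → E →L[ℂ] E, DifferentiableOn ℂ G (Metric.ball 0 1) ∧
      (∀ u ∈ Metric.ball (0 : ℂ) 1, ‖G u‖ ≤ 1) ∧
      ∀ i x y, inner ℂ (G (t i) x) y = inner ℂ x (W i y) := by
  classical
  have : CompleteSpace E := FiniteDimensional.complete ℂ E
  have : CompleteSpace M := FiniteDimensional.complete ℂ M
  let e : E × M →ₗ[ℂ] WithLp 2 (E × M) := (WithLp.linearEquiv 2 ℂ (E × M)).symm.toLinearMap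
  let f : (ι → E) →ₗ[ℂ] WithLp 2 (E × M) := ∑ i, e ∘ₗ
    (LinearMap.prod LinearMap.id (conj (t i) • V i)) ∘ₗ LinearMap.proj i
  let g : (ι → E) →ₗ[ℂ] WithLp 2 (E × M) := ∑ i, e ∘ₗ
    (LinearMap.prod (W i) (V i)) ∘ₗ LinearMap.proj i
  have hf : ∀ x, f x = ∑ i, WithLp.toLp 2 (x i, conj (t i) • V i (x i)) := fun x => by
    simp only [f, LinearMap.sum_apply]
    rfl
  have hg : ∀ x, g x = ∑ i, WithLp.toLp 2 (W i (x i), V i (x i)) := fun x => by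
    simp only [g, LinearMap.sum_apply]
    rfl
  -- The hypothesis `h` says exactly that the vectors `(x, conj (t i) V i x)` and `(W i x, V i x)`
  -- have the same Gram matrix.
  have hfg : ∀ x, ‖f x‖ = ‖g x‖ := fun x => by
    have h1 : inner ℂ (f x) (f x) = inner ℂ (g x) (g x) := by
      rw [hf, hg]
      simp only [sum_inner, inner_sum, inner_toLp_prod]
      refine Finset.sum_congr rfl fun i _ => Finset.sum_congr rfl fun j _ => ?_
      have := h j i (x j) (x i)
      simp only [inner_smul_left, inner_smul_right, Complex.conj_conj]
      rw [← this]
      ring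
    rw [@norm_eq_sqrt_re_inner ℂ, @norm_eq_sqrt_re_inner ℂ, h1]
  obtain ⟨U, hU⟩ := exists_isometry_comp_eq f g hfg
  have hU' : ∀ i x, U (WithLp.toLp 2 (x, conj (t i) • V i x)) = WithLp.toLp 2 (W i x, V i x) := by
    intro i x
    have h1 := hU (Pi.single i x)
    rw [hf, hg, Finset.sum_eq_single i, Finset.sum_eq_single i] at h1
    · simpa using h1
    · intro j _ hj
      simp [hj]
    · simp
    · intro j _ hj
      simp [hj]
    · simp
  -- Passing to the adjoint turns `conj (t i)` into `t i`, so that the transfer function is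
  -- holomorphic in `t`.
  set C := U.toContinuousLinearMap.adjoint with hCdef
  have hC : ∀ p, ‖C p‖ ≤ ‖p‖ := fun p => by
    have h1 : ‖C‖ ≤ 1 := by
      rw [hCdef, LinearIsometryEquiv.norm_map]
      exact U.norm_toContinuousLinearMap_le
    exact (C.le_opNorm p).trans (mul_le_of_le_one_left (norm_nonneg _) h1)
  obtain ⟨G, hG, hGs⟩ := exists_transfer C hC
  refine ⟨G, hG, fun u hu => ?_, fun i x y => ?_⟩
  · refine ContinuousLinearMap.opNorm_le_bound _ zero_le_one fun x => ?_
    obtain ⟨s, hs⟩ := hGs u hu x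
    have h2 := pow_le_pow_left₀ (norm_nonneg _) (hC (WithLp.toLp 2 (x, u • s))) 2
    rw [hs, norm_toLp_prod_sq, norm_toLp_prod_sq, norm_smul] at h2
    have hu' : ‖u‖ < 1 := by simpa using hu
    rw [one_mul]
    refine le_of_sq_le_sq ?_ (norm_nonneg _)
    have h3 : (‖u‖ * ‖s‖) ^ 2 ≤ ‖s‖ ^ 2 := by
      gcongr
      exact mul_le_of_le_one_left (norm_nonneg _) hu'.le
    linarith
  · obtain ⟨s, hs⟩ := hGs (t i) (by simpa using ht i) x
    have h1 := ContinuousLinearMap.adjoint_inner_left U.toContinuousLinearMap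
      (WithLp.toLp 2 (y, conj (t i) • V i y)) (WithLp.toLp 2 (x, t i • s))
    rw [← hCdef, hs, LinearIsometry.coe_toContinuousLinearMap, hU'] at h1
    simp only [inner_toLp_prod, inner_smul_left, inner_smul_right] at h1
    -- Both sides contain the same term pairing `s` with `V i y`.
    exact add_right_cancel h1

end Realization

/-! ### Matrices of bounded invariant functions -/

section Norm

open scoped Matrix.Norms.L2Operator

variable {Γ : Subgroup (Equiv.Perm 𝔻)} {k : ℕ}

/-- A real supremum over an unbounded family is `0` by default, so `supNorm F ≤ 1` bounds the values
only once boundedness is known. -/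
lemma bddAbove_norm_evalAt (F : Matrix (Fin k) (Fin k) (HInfty Γ)) :
    BddAbove (Set.range fun z : 𝔻 => ‖evalAt F z‖) := by
  choose C hC using fun l m => (F l m).2.2.1
  refine ⟨∑ l, ∑ m, C l m * ‖(Matrix.single l m 1 : Matrix (Fin k) (Fin k) ℂ)‖, ?_⟩
  rintro _ ⟨z, rfl⟩
  change ‖evalAt F z‖ ≤ _
  rw [Matrix.matrix_eq_sum_single (evalAt F z)]
  refine (norm_sum_le _ _).trans (Finset.sum_le_sum fun l _ => (norm_sum_le _ _).trans
    (Finset.sum_le_sum fun m _ => ?_))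
  have h : Matrix.single l m (evalAt F z l m) = evalAt F z l m • Matrix.single l m (1 : ℂ) := by
    rw [Matrix.smul_single, smul_eq_mul, mul_one]
  rw [h, norm_smul]
  exact mul_le_mul_of_nonneg_right (hC l m z) (norm_nonneg _)

lemma norm_evalAt_le (F : Matrix (Fin k) (Fin k) (HInfty Γ)) (z : 𝔻) :
    ‖evalAt F z‖ ≤ supNorm F :=
  le_ciSup (bddAbove_norm_evalAt F) z

lemma sum_norm_mulVec_sq_le {A : Matrix (Fin k) (Fin k) ℂ} (hA : ‖A‖ ≤ 1) (x : Fin k → ℂ) :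
    ∑ l, ‖∑ m, A l m * x m‖ ^ 2 ≤ ∑ m, ‖x m‖ ^ 2 := by
  have h := Matrix.l2_opNorm_mulVec A (WithLp.toLp 2 x)
  have h2 := pow_le_pow_left₀ (norm_nonneg _)
    (h.trans (mul_le_of_le_one_left (norm_nonneg _) hA)) 2
  rw [EuclideanSpace.norm_sq_eq, EuclideanSpace.norm_sq_eq] at h2
  exact h2

lemma isHolo_evalAt (F : Matrix (Fin k) (Fin k) (HInfty Γ)) (l m : Fin k) :
    IsHolo fun z => evalAt F z l m :=
  (F l m).2.1

lemma evalAt_invariant (F : Matrix (Fin k) (Fin k) (HInfty Γ)) {γ : Equiv.Perm 𝔻} (hγ : γ ∈ Γ)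
    (z : 𝔻) : evalAt F (γ z) = evalAt F z := by
  ext l m
  exact congrFun ((F l m).2.2.2 γ hγ) z

/-- A matrix of sup norm at most one acts contractively on tuples of invariant functions. -/
lemma exists_mul_hardy {F : Matrix (Fin k) (Fin k) (HInfty Γ)} (hF : supNorm F ≤ 1)
    (v : Fin k → Hardy) (hv : ∀ m, v m ∈ HTwo Γ) : ∃ w : Fin k → Hardy, (∀ l, w l ∈ HTwo Γ) ∧
      (∀ l z, hardyFun (w l) z = ∑ m, evalAt F z l m * hardyFun (v m) z) ∧
      ∑ l, ‖w l‖ ^ 2 ≤ ∑ m, ‖v m‖ ^ 2 := by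
  obtain ⟨w, hw, hle⟩ := exists_hardy_of_dominated
    (f := fun l z => ∑ m, evalAt F z l m * hardyFun (v m) z)
    (fun l => isHolo_sum _ fun m _ => (isHolo_evalAt F l m).mul (isHolo_hardyFun (v m))) v
    fun z => sum_norm_mulVec_sq_le ((norm_evalAt_le F z).trans hF) _
  refine ⟨w, fun l γ hγ => funext fun z => ?_, hw, hle⟩
  rw [Function.comp_apply, hw, hw, evalAt_invariant F hγ]
  exact Finset.sum_congr rfl fun m _ => congrArg _ (congrFun (hv m γ hγ) z)

end Norm

/-! ### Necessity of positivity -/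

section Necessity

variable {n k : ℕ}

lemma pickMatrix_apply (K : 𝔻 → 𝔻 → ℂ) (z : Fin n → 𝔻) (W : Fin n → Matrix (Fin k) (Fin k) ℂ)
    (i j : Fin n) (l m : Fin k) : pickMatrix K z W (i, l) (j, m) =
      K (z i) (z j) * (1 - W i * (W j).conjTranspose) l m := rfl

lemma isHermitian_pickMatrix {K : 𝔻 → 𝔻 → ℂ} (hK : ∀ u v, conj (K u v) = K v u) (z : Fin n → 𝔻)
    (W : Fin n → Matrix (Fin k) (Fin k) ℂ) : (pickMatrix K z W).IsHermitian := by
  ext ⟨i, l⟩ ⟨j, m⟩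
  have h : (1 - W j * (W i).conjTranspose).conjTranspose = 1 - W i * (W j).conjTranspose := by
    simp [Matrix.conjTranspose_mul]
  rw [Matrix.conjTranspose_apply, pickMatrix_apply, pickMatrix_apply, ← h,
    Matrix.conjTranspose_apply, star_mul', ← hK (z j) (z i)]
  rfl

/-- For a Gram kernel each of the two sums is a sum of squared norms, by `sum_inner_self_eq`. -/
lemma dotProduct_pickMatrix (K : 𝔻 → 𝔻 → ℂ) (z : Fin n → 𝔻)
    (W : Fin n → Matrix (Fin k) (Fin k) ℂ) (x : Fin n × Fin k → ℂ) :
    star x ⬝ᵥ (pickMatrix K z W).mulVec x = ∑ i, ∑ j, K (z i) (z j) *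
      (∑ l, conj (x (i, l)) * x (j, l) -
        ∑ p, conj ((W i).conjTranspose.mulVec (fun l => x (i, l)) p) *
          (W j).conjTranspose.mulVec (fun l => x (j, l)) p) := by
  have h : ∀ i j, ∑ l, conj (x (i, l)) * x (j, l) -
        ∑ p, conj ((W i).conjTranspose.mulVec (fun l => x (i, l)) p) *
          (W j).conjTranspose.mulVec (fun l => x (j, l)) p =
      ∑ l, ∑ m, conj (x (i, l)) * ((1 - W i * (W j).conjTranspose) l m * x (j, m)) := by
    intro i j
    have h1 : (star fun l => x (i, l)) ⬝ᵥ
        (1 - W i * (W j).conjTranspose).mulVec (fun m => x (j, m)) =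
        (star fun l => x (i, l)) ⬝ᵥ (fun m => x (j, m)) -
        (star ((W i).conjTranspose.mulVec fun l => x (i, l))) ⬝ᵥ
          ((W j).conjTranspose.mulVec fun m => x (j, m)) := by
      rw [Matrix.sub_mulVec, dotProduct_sub, Matrix.one_mulVec, ← Matrix.mulVec_mulVec,
        Matrix.dotProduct_mulVec _ (W i), Matrix.star_mulVec, Matrix.conjTranspose_conjTranspose]
    simp only [← Finset.mul_sum]
    exact h1.symm
  simp only [h]
  simp only [dotProduct, Matrix.mulVec, Fintype.sum_prod_type, pickMatrix_apply]
  refine Finset.sum_congr rfl fun i _ => ?_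
  simp only [Finset.mul_sum]
  rw [Finset.sum_comm]
  refine Finset.sum_congr rfl fun j _ => Finset.sum_congr rfl fun l _ =>
    Finset.sum_congr rfl fun m _ => ?_
  rw [Pi.star_apply, RCLike.star_def]
  ring

lemma sum_inner_self_eq {ι : Type*} [Fintype ι] (κ : Fin n → Hardy) (y : Fin n → ι → ℂ) :
    ∑ i, ∑ j, inner ℂ (κ i) (κ j) * ∑ l, conj (y i l) * y j l =
      ((∑ l, ‖∑ j, y j l • κ j‖ ^ 2 : ℝ) : ℂ) := by
  have h : ∀ l, ((‖∑ j, y j l • κ j‖ ^ 2 : ℝ) : ℂ) =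
      ∑ i, ∑ j, inner ℂ (κ i) (κ j) * (conj (y i l) * y j l) := fun l => by
    have h1 := inner_self_eq_norm_sq_to_K (𝕜 := ℂ) (∑ j, y j l • κ j)
    simp only [sum_inner, inner_sum, inner_smul_left, inner_smul_right,
      Finset.mul_sum] at h1
    push_cast
    refine h1.symm.trans ?_
    rw [Finset.sum_comm]
    refine Finset.sum_congr rfl fun i _ => Finset.sum_congr rfl fun j _ => ?_
    ring
  rw [Complex.ofReal_sum]
  simp only [h, Finset.mul_sum]
  conv_rhs => rw [Finset.sum_comm]
  exact Finset.sum_congr rfl fun i _ => Finset.sum_comm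

/-- The Pick form at `x` is `‖u‖² - ‖v‖²`, where `v` plays the role of the adjoint of multiplication
by `F` applied to `u`. With `w = F v`, reproduction gives `⟨u, w⟩ = ‖v‖²`, so `2 ‖v‖² ≤ ‖u‖² + ‖w‖²
≤ ‖u‖² + ‖v‖²`. -/
theorem posSemidef_pickMatrix_invKernel {Γ : Subgroup (Equiv.Perm 𝔻)}
    {F : Matrix (Fin k) (Fin k) (HInfty Γ)} (hF : supNorm F ≤ 1) (z : Fin n → 𝔻) :
    (pickMatrix (invKernel Γ) z fun j => evalAt F (z j)).PosSemidef := by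
  have hK : ∀ u v, invKernel Γ u v = inner ℂ (invSzego Γ u : Hardy) (invSzego Γ v : Hardy) :=
    fun u v => by rw [inner_invSzego u (invSzego Γ v).2, invKernel_eq_hardyFun]
  refine Matrix.PosSemidef.of_dotProduct_mulVec_nonneg
    (isHermitian_pickMatrix (fun u v => by rw [hK, hK, inner_conj_symm]) z _) fun x => ?_
  set y : Fin n → Fin k → ℂ :=
    fun j => (evalAt F (z j)).conjTranspose.mulVec fun l => x (j, l) with hy
  set u : Fin k → Hardy := fun l => ∑ j, x (j, l) • (invSzego Γ (z j) : Hardy) with hu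
  set v : Fin k → Hardy := fun p => ∑ j, y j p • (invSzego Γ (z j) : Hardy) with hv
  have hvmem : ∀ p, v p ∈ HTwo Γ := fun p =>
    (HTwo Γ).sum_mem fun j _ => (HTwo Γ).smul_mem _ (invSzego Γ (z j)).2
  obtain ⟨w, hw, hwv, hle⟩ := exists_mul_hardy hF v hvmem
  have hinner : ∑ l, inner ℂ (u l) (w l) = ∑ p, inner ℂ (v p) (v p) := by
    have h1 : ∀ l, inner ℂ (u l) (w l) =
        ∑ j, ∑ p, conj (x (j, l)) * (evalAt F (z j) l p * hardyFun (v p) (z j)) := fun l => by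
      simp only [hu, sum_inner, inner_smul_left]
      refine Finset.sum_congr rfl fun j _ => ?_
      rw [inner_invSzego _ (hw l), hwv, Finset.mul_sum]
    have h2 : ∀ p, inner ℂ (v p) (v p) =
        ∑ j, ∑ l, conj (x (j, l)) * (evalAt F (z j) l p * hardyFun (v p) (z j)) := fun p => by
      conv_lhs => rw [hv]
      simp only [sum_inner, inner_smul_left]
      refine Finset.sum_congr rfl fun j _ => ?_
      rw [inner_invSzego _ (hvmem p)]
      simp only [hy, Matrix.mulVec, dotProduct, Matrix.conjTranspose_apply, map_sum, map_mul,
        RCLike.star_def, Complex.conj_conj, Finset.sum_mul]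
      refine Finset.sum_congr rfl fun l _ => ?_
      ring
    simp only [h1, h2]
    rw [Finset.sum_comm]
    conv_rhs => rw [Finset.sum_comm]
    exact Finset.sum_congr rfl fun j _ => Finset.sum_comm
  have hvu : ∑ p, ‖v p‖ ^ 2 ≤ ∑ l, ‖u l‖ ^ 2 := by
    have h1 : ∑ l, (inner ℂ (u l) (w l)).re = ∑ p, ‖v p‖ ^ 2 := by
      rw [← Complex.re_sum, hinner, Complex.re_sum]
      exact Finset.sum_congr rfl fun p _ => inner_self_eq_norm_sq (𝕜 := ℂ) (v p)
    have h2 : ∑ l, (2 * (inner ℂ (u l) (w l)).re) ≤ ∑ l, (‖u l‖ ^ 2 + ‖w l‖ ^ 2) :=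
      Finset.sum_le_sum fun l _ => by
        have h3 := @norm_sub_sq ℂ _ _ _ _ (u l) (w l)
        simp only [RCLike.re_to_complex] at h3
        nlinarith [sq_nonneg ‖u l - w l‖]
    rw [← Finset.mul_sum, Finset.sum_add_distrib, h1] at h2
    linarith
  have hval : star x ⬝ᵥ (pickMatrix (invKernel Γ) z fun j => evalAt F (z j)).mulVec x =
      ((∑ l, ‖u l‖ ^ 2 - ∑ p, ‖v p‖ ^ 2 : ℝ) : ℂ) := by
    rw [dotProduct_pickMatrix]
    simp only [hK, mul_sub, Finset.sum_sub_distrib]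
    rw [Complex.ofReal_sub]
    exact congrArg₂ _ (sum_inner_self_eq (fun j => (invSzego Γ (z j) : Hardy)) fun j l => x (j, l))
      (sum_inner_self_eq (fun j => (invSzego Γ (z j) : Hardy)) y)
  rw [hval, Complex.zero_le_real]
  linarith

end Necessity

/-! ### Sufficiency of positivity -/

section Sufficiency

open scoped Matrix.Norms.L2Operator

variable {n k : ℕ}

lemma toEuclideanCLM_single (A : Matrix (Fin k) (Fin k) ℂ) (l m : Fin k) :
    Matrix.toEuclideanCLM (n := Fin k) (𝕜 := ℂ) A (WithLp.toLp 2 (Pi.single m 1)) l = A l m := by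
  rw [Matrix.toEuclideanCLM_toLp]
  simp

theorem exists_matrix_interpolant {t : 𝔻 → ℂ} (ht : ∀ z, ‖t z‖ < 1) (z : Fin n → 𝔻)
    (W : Fin n → Matrix (Fin k) (Fin k) ℂ)
    (hP : (pickMatrix (fun u v => 1 / (1 - t u * conj (t v))) z W).PosSemidef) :
    ∃ G : ℂ → Matrix (Fin k) (Fin k) ℂ, (∀ l m, DifferentiableOn ℂ (fun u => G u l m)
      (Metric.ball 0 1)) ∧ (∀ u ∈ Metric.ball (0 : ℂ) 1, ‖G u‖ ≤ 1) ∧ ∀ j, G (t (z j)) = W j := by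
  obtain ⟨r, v, hv⟩ := Matrix.posSemidef_iff_eq_sum_vecMulVec.mp hP
  set A : Matrix (Fin r) (Fin n × Fin k) ℂ := Matrix.of fun s p => star (v s p) with hAdef
  have hA : pickMatrix (fun u v => 1 / (1 - t u * conj (t v))) z W = A.conjTranspose * A := by
    rw [hv]
    ext p q
    simp [Matrix.sum_apply, Matrix.vecMulVec_apply, Matrix.mul_apply, hAdef]
  -- The column blocks of the Gram factor `A`; multiplying the block identity by `1 - t_i conj t_j`
  -- gives the hypothesis of `exists_interpolant`, with `W j` replaced by its adjoint.
  set V : Fin n → Matrix (Fin r) (Fin k) ℂ := fun j => A.submatrix id fun l => (j, l)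
  have hne : ∀ u v, 1 - t u * conj (t v) ≠ 0 := fun u v h => by
    have h1 := congrArg norm (sub_eq_zero.mp h)
    rw [norm_one, norm_mul, RCLike.norm_conj] at h1
    nlinarith [ht u, ht v, norm_nonneg (t u), norm_nonneg (t v)]
  have hV : ∀ i j, (1 - t (z i) * conj (t (z j))) • ((V i).conjTranspose * V j) =
      1 - W i * (W j).conjTranspose := fun i j => by
    ext l m
    have h1 := congrFun (congrFun hA (i, l)) (j, m)
    rw [pickMatrix_apply] at h1
    have h2 : ((V i).conjTranspose * V j) l m = (A.conjTranspose * A) (i, l) (j, m) := rfl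
    rw [Matrix.smul_apply, h2, ← h1, smul_eq_mul, ← mul_assoc, mul_one_div_cancel (hne _ _),
      one_mul]
  have hin : ∀ {p : Type} [Fintype p] (X Y : Matrix p (Fin k) ℂ) (x y : EuclideanSpace ℂ (Fin k)),
      inner ℂ (Matrix.toLpLin 2 2 X x) (Matrix.toLpLin 2 2 Y y) =
        star (WithLp.ofLp x) ⬝ᵥ (X.conjTranspose * Y).mulVec (WithLp.ofLp y) := by
    intro p _ X Y x y
    rw [EuclideanSpace.inner_eq_star_dotProduct, dotProduct_comm, ← Matrix.mulVec_mulVec,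
      Matrix.dotProduct_mulVec, ← Matrix.star_mulVec]
    rfl
  obtain ⟨G, hG, hG1, hGt⟩ := exists_interpolant (fun j => t (z j)) (fun j => ht (z j))
    (fun j => Matrix.toLpLin 2 2 (W j).conjTranspose) (fun j => Matrix.toLpLin 2 2 (V j))
    fun i j x y => by
      have h1 : inner ℂ x y = star (WithLp.ofLp x) ⬝ᵥ
          (1 : Matrix (Fin k) (Fin k) ℂ).mulVec (WithLp.ofLp y) := by
        rw [Matrix.one_mulVec, EuclideanSpace.inner_eq_star_dotProduct, dotProduct_comm]
      have h2 := congrArg (fun X : Matrix (Fin k) (Fin k) ℂ =>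
        star (WithLp.ofLp x) ⬝ᵥ X.mulVec (WithLp.ofLp y)) (hV i j)
      simp only [Matrix.smul_mulVec, Matrix.sub_mulVec, dotProduct_sub, dotProduct_smul,
        smul_eq_mul] at h2
      rw [h1, hin, hin, Matrix.conjTranspose_conjTranspose]
      linear_combination -h2
  refine ⟨fun u => (Matrix.toEuclideanCLM (n := Fin k) (𝕜 := ℂ)).symm (G u), fun l m => ?_,
    fun u hu => ?_, fun j => ?_⟩
  · have h1 : ∀ u, (Matrix.toEuclideanCLM (n := Fin k) (𝕜 := ℂ)).symm (G u) l m =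
        G u (WithLp.toLp 2 (Pi.single m 1)) l := fun u => by
      conv_rhs => rw [← (Matrix.toEuclideanCLM (n := Fin k) (𝕜 := ℂ)).apply_symm_apply (G u)]
      exact (toEuclideanCLM_single _ l m).symm
    simp only [h1]
    exact (EuclideanSpace.proj (𝕜 := ℂ) l).differentiable.comp_differentiableOn
      (hG.clm_apply (differentiableOn_const _))
  · rw [← Matrix.l2_opNorm_toEuclideanCLM, StarAlgEquiv.apply_symm_apply]
    exact hG1 u hu
  · suffices hGW : G (t (z j)) = Matrix.toEuclideanCLM (n := Fin k) (𝕜 := ℂ) (W j) by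
      simp only [hGW, StarAlgEquiv.symm_apply_apply]
    refine ContinuousLinearMap.ext fun x => ext_inner_right ℂ fun y => ?_
    have h1 := hin (W j) 1 x y
    have h2 := hin 1 (W j).conjTranspose x y
    rw [Matrix.toLpLin_one, LinearMap.id_apply, mul_one] at h1
    rw [Matrix.toLpLin_one, LinearMap.id_apply, Matrix.conjTranspose_one, one_mul] at h2
    exact (hGt j x y).trans (h2.trans h1.symm)

end Sufficiency

/-! ### Composition of the interpolant with the square of the Blaschke product -/

section Sufficiency

open scoped Matrix.Norms.L2Operator

lemma norm_apply_le_one {k : ℕ} {A : Matrix (Fin k) (Fin k) ℂ} (hA : ‖A‖ ≤ 1) (l m : Fin k) :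
    ‖A l m‖ ≤ 1 := by
  have h := sum_norm_mulVec_sq_le hA (Pi.single m 1)
  have h1 := Finset.single_le_sum (f := fun l => ‖∑ p, A l p * (Pi.single m 1 : Fin k → ℂ) p‖ ^ 2)
    (fun _ _ => by positivity) (Finset.mem_univ l)
  have h2 : ∑ p, ‖(Pi.single m 1 : Fin k → ℂ) p‖ ^ 2 = 1 := by
    rw [Finset.sum_eq_single m (fun p _ hp => by simp [hp]) (by simp)]
    simp
  have h3 : ∑ p, A l p * (Pi.single m 1 : Fin k → ℂ) p = A l m := by
    rw [Finset.sum_eq_single m (fun p _ hp => by simp [hp]) (by simp)]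
    simp
  rw [h2] at h
  simp only [h3] at h1
  exact (sq_le_one_iff₀ (norm_nonneg _)).mp (h1.trans h)

variable (a : ℝ) (ha : a ∈ Set.Ioo (0 : ℝ) 1)

lemma norm_orbitBlaschke_sq_lt_one (z : 𝔻) : ‖orbitBlaschke a ha z ^ 2‖ < 1 := by
  rw [norm_pow]
  exact pow_lt_one₀ (norm_nonneg _) (norm_orbitBlaschke_lt_one a ha z) two_ne_zero

/-- Composition of a holomorphic function on the disc with the square of the Blaschke product. -/
def compOrbitBlaschkeSq {g : ℂ → ℂ} (hg : DifferentiableOn ℂ g (Metric.ball 0 1))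
    (hb : ∀ u ∈ Metric.ball (0 : ℂ) 1, ‖g u‖ ≤ 1) : HInfty (Gamma2 a ha) :=
  ⟨fun z => g (orbitBlaschke a ha z ^ 2), by
    have hmem : ∀ z, orbitBlaschke a ha z ^ 2 ∈ Metric.ball (0 : ℂ) 1 := fun z => by
      simpa only [mem_ball_zero_iff] using norm_orbitBlaschke_sq_lt_one a ha z
    refine ⟨?_, ⟨1, fun z => hb _ (hmem z)⟩, fun γ hγ => funext fun z => ?_⟩
    · obtain ⟨B, hB, h⟩ := isHolo_orbitBlaschke a ha
      refine ⟨fun w => g (B w ^ 2), hg.comp (hB.pow 2) fun w hw => ?_, fun z => by simp only [h]⟩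
      have h1 := h (.mk w (by simpa using hw))
      rw [Complex.UnitDisc.coe_mk] at h1
      simpa only [h1] using hmem (.mk w (by simpa using hw))
    · rw [Function.comp_apply, orbitBlaschke_sq_invariant a ha hγ]⟩

theorem exists_interpolant_of_posSemidef {n k : ℕ} (z : Fin n → 𝔻)
    (W : Fin n → Matrix (Fin k) (Fin k) ℂ)
    (hP : (pickMatrix (fun u v => 1 / (1 - orbitBlaschke a ha u ^ 2 *
      conj (orbitBlaschke a ha v ^ 2))) z W).PosSemidef) :
    ∃ F : Matrix (Fin k) (Fin k) (HInfty (Gamma2 a ha)),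
      supNorm F ≤ 1 ∧ ∀ j, evalAt F (z j) = W j := by
  obtain ⟨G, hG, hG1, hGW⟩ := exists_matrix_interpolant (norm_orbitBlaschke_sq_lt_one a ha) z W hP
  let F : Matrix (Fin k) (Fin k) (HInfty (Gamma2 a ha)) := fun l m =>
    compOrbitBlaschkeSq a ha (hG l m) fun u hu => norm_apply_le_one (hG1 u hu) l m
  have hF : ∀ w, evalAt F w = G (orbitBlaschke a ha w ^ 2) := fun w => rfl
  refine ⟨F, ciSup_le fun w => ?_, fun j => (hF _).trans (hGW j)⟩
  rw [hF]
  refine hG1 _ ?_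
  simpa only [mem_ball_zero_iff] using norm_orbitBlaschke_sq_lt_one a ha w

end Sufficiency

end PickDisc

end

/-! ### The interpolation theorem -/

theorem corollary6p7 (a : ℝ) (ha : a ∈ Set.Ioo (0 : ℝ) 1) {n k : ℕ}
    (z : Fin n → 𝔻) (W : Fin n → Matrix (Fin k) (Fin k) ℂ) :
    let Γ₁ := PickDisc.Gamma1 a ha
    let Γ₂ := PickDisc.Gamma2 a ha
    let B : 𝔻 → ℂ := PickDisc.blaschkeProduct (MulAction.orbit Γ₂ (0 : 𝔻))
    let P := PickDisc.pickMatrix (fun u v => 1 / (1 - B u ^ 2 * conj (B v ^ 2))) z W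
    -- the two orbits agree, and the Blaschke product converges
    MulAction.orbit Γ₂ (0 : 𝔻) = MulAction.orbit Γ₁ (0 : 𝔻) ∧
    (∀ w : 𝔻, Multipliable fun ζ : MulAction.orbit Γ₂ (0 : 𝔻) => PickDisc.blaschkeFactor ζ w) ∧
    -- the Pick matrix is the one formed with the reproducing kernel
    P = PickDisc.pickMatrix (PickDisc.invKernel Γ₂) z W ∧
    -- the interpolation criterion
    ((∃ F : Matrix (Fin k) (Fin k) (PickDisc.HInfty Γ₂),
        PickDisc.supNorm F ≤ 1 ∧ ∀ j, PickDisc.evalAt F (z j) = W j) ↔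
      P.PosSemidef) := by
  intro Γ₁ Γ₂ B P
  have hB : B = PickDisc.orbitBlaschke a ha := by
    funext w
    simp only [B, Γ₂, PickDisc.orbit_Gamma2]
    rfl
  have hP : P = PickDisc.pickMatrix (PickDisc.invKernel Γ₂) z W := by
    simp only [P, hB]
    congr 1
    funext u v
    exact (PickDisc.invKernel_Gamma2 a ha u v).symm
  refine ⟨(PickDisc.orbit_Gamma2 a ha).trans (PickDisc.orbit_Gamma1 a ha).symm, fun w => ?_, hP,
    ?_, fun h => ?_⟩
  · have h := PickDisc.multipliable_orbit a ha w
    rwa [← PickDisc.orbit_Gamma2] at h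
  · rintro ⟨F, hF, hW⟩
    obtain rfl : (fun j => PickDisc.evalAt F (z j)) = W := funext hW
    rw [hP]
    exact PickDisc.posSemidef_pickMatrix_invKernel hF z
  · refine PickDisc.exists_interpolant_of_posSemidef a ha z W ?_
    simpa only [P, hB] using h
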